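/- **Setting.** Let $\tilde k((z,x),(z',x'))=k_{\mathcal Z}(z,z')\,k_{\mathcal X}(x,x')$ be the product of symmetric positive semidefinite kernels $k_{\mathcal Z}$ on $\mathcal Z$ and $k_{\mathcal X}$ on $\mathcal X$, with $\tilde k(\tilde x,\tilde x)\le c_{\tilde k}$ for all $\tilde x\in\mathcal Z\times\mathcal X$, and let $f^*$ be an element of its reproducing kernel Hilbert space with $\|f^*\|\le c$. Let $\lambda>0$, $\delta>0$, $T\ge 1$, and let there be $N\ge1$ arms with known descriptors $z_a\in\mathcal Z$ (so that the task similarity matrix $[k_{\mathcal Z}(z_a,z_{a'})]$ is known). In round $t=1,\dots,T$ the contexts $x_{a,t}\in\mathcal X$ of all arms $a$ are shown (an arbitrary fixed sequence); put $\tilde x_{a,t}=(z_a,x_{a,t})$. The rewards satisfy $r_{a,t}\in[0,1]$ almost surely and $\mathbb E[r_{a,t}]=f^*(\tilde x_{a,t})$, and the reward vectors $(r_{a,t})_{a}$, $t=1,\dots,T$, are independent. Let $a_t^*$ be an arm with maximal expected reward in round $t$. **Algorithm (SupKMTL-UCB).** Put $\alpha=\sqrt{\tfrac12\log\big(2TN(\log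 T+1)/\delta\big)}$ and $\Psi^q=\emptyset$ for all $q\ge1$. In round $t$ start with $q=1$ and $\hat A_1=\{1,\dots,N\}$. At stage $q$ let, with $\Psi=\Psi^q$, $\tilde K_\Psi=[\tilde k(\tilde x_{a_\tau,\tau},\tilde x_{a_{\tau'},\tau'})]_{\tau,\tau'\in\Psi}$, $\tilde k_{a}=[\tilde k(\tilde x_{a,t},\tilde x_{a_\tau,\tau})]_{\tau\in\Psi}$ and $y_\Psi=[r_{a_\tau,\tau}]_{\tau\in\Psi}$, $$w_{a}=(\alpha+c\sqrt\lambda)\,\lambda^{-1/2}\sqrt{\tilde k(\tilde x_{a,t},\tilde x_{a,t})-\tilde k_a^{T}(\tilde K_\Psi+\lambda I)^{-1}\tilde k_a},\qquad \mathrm{ucb}_{a}=\tilde k_a^{T}(\tilde K_\Psi+\lambda I)^{-1}y_\Psi+w_{a}.$$ (1) If $w_a\le 1/\sqrt T$ for all $a\in\hat A_q$, choose $a_t\in\hat A_q$ with maximal $\mathrm{ucb}_a$. (2) Otherwise, if $w_a\le2^{-q}$ for all $a\in\hat A_q$, put $\hat A_{q+1}=\{a\in\hat A_q:\mathrm{ucb}_a\ge\max_{a'\in\hat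 A_q}\mathrm{ucb}_{a'}-2^{1-q}\}$ and go to stage $q+1$. (3) Otherwise choose some $a_t\in\hat A_q$ with $w_{a_t}>2^{-q}$ and add $t$ to $\Psi^q$. Then observe $r_{a_t,t}$. Whenever several arms qualify as $a_t$, the choice is made by a fixed rule that depends only on $t$, $q$ and the set of qualifying arms. **Regret.** Let $R(T)=\sum_{t=1}^T r_{a_t^*,t}-\sum_{t=1}^T r_{a_t,t}$ and $\bar R(T)=\sum_{t=1}^T f^*(\tilde x_{a_t^*,t})-\sum_{t=1}^T f^*(\tilde x_{a_t,t})$. Let $m=\max(1,c_{\tilde k}/\lambda)$ and $g([T])=\det(\tilde K_{T+1}+\lambda I)/\lambda^{T+1}$, where $\tilde K_{T+1}$ is the kernel matrix of $\tilde x_{a_1,1},\dots,\tilde x_{a_T,T}$ and one further, arbitrary, augmented context $\tilde x_{T+1}$. **Theorem.** There is a constant $C$ that depends only on $N,\lambda,c,c_{\tilde k},\delta$ such that, in this setting, there is an event of probability at least $1-\delta$ on which, for every choice of $\tilde x_{T+1}$, the following holds. Put $$B=2\sqrt T+10\left(\sqrt{\frac{\log\big(2TN(\log T+1)/\delta\big)}{2}}+c\sqrt\lambda\right)\sqrt{2m\log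 g([T])}\,\sqrt{T\lceil\log T\rceil}.$$ Then $\bar R(T)\le B$. If moreover $T=1$ or $2m\lceil\log T\rceil\log g([T])\ge1$ (which holds, for example, as soon as $T\ge2$ and $\log g([T])\ge\frac12$), then also $R(T)\le B$, and for $T\ge2$ $$R(T)\le C\,\log T\,\sqrt{T\log g([T])},$$ that is, $R(T)=O\big(\sqrt{T\log g([T])}\big)$ up to a factor logarithmic in $T$. -/

import Mathlib

open MeasureTheory ProbabilityTheory
open scoped Matrix

noncomputable section

namespace KMTL

/-- The product kernel `k̃((z, x), (z', x')) = k_Z(z, z') k_X(x, x')` on `Z × X`. -/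
def productKernel {Z X : Type*} (kZ : Z → Z → ℝ) (kX : X → X → ℝ) (p q : Z × X) : ℝ :=
  kZ p.1 q.1 * kX p.2 q.2

/-- A real kernel is symmetric and positive semidefinite: all its finite quadratic forms are
nonnegative. -/
def IsSPDKernel {X : Type*} (k : X → X → ℝ) : Prop :=
  (Matrix.of k).PosSemidef

section Base

variable {X : Type*} (k : X → X → ℝ) (lam : ℝ) (S : Finset ℕ) (p : ℕ → X)

/-- The kernel matrix `K̃_Ψ` of the points `p τ`, `τ ∈ Ψ`. -/
def gram : Matrix S S ℝ := Matrix.of fun i j => k (p i) (p j)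

/-- The vector `k̃_Ψ(x)` of kernel evaluations between `x` and the points `p τ`, `τ ∈ Ψ`. -/
def kernelVec (x : X) : S → ℝ := fun i => k x (p i)

/-- `s = λ^{-1/2} √(k(x,x) - k_Ψ(x)ᵀ (K_Ψ + λ I)⁻¹ k_Ψ(x))`. -/
def stdWidth (x : X) : ℝ :=
  (√lam)⁻¹ * √(k x x -
    kernelVec k S p x ⬝ᵥ ((gram k S p + lam • (1 : Matrix S S ℝ))⁻¹ *ᵥ kernelVec k S p x))

/-- The kernel ridge estimate `k_Ψ(x)ᵀ (K_Ψ + λ I)⁻¹ y_Ψ`. -/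
def ridgeEstimate (y : ℕ → ℝ) (x : X) : ℝ :=
  kernelVec k S p x ⬝ᵥ ((gram k S p + lam • (1 : Matrix S S ℝ))⁻¹ *ᵥ fun i : S => y i)

end Base

/-- `det (K + λ I) / λⁿ` for the kernel matrix `K` of the points `p 0, …, p (n-1)`. -/
def gainDet {X : Type*} (k : X → X → ℝ) (lam : ℝ) {n : ℕ} (p : Fin n → X) : ℝ :=
  (Matrix.of (fun i j => k (p i) (p j)) + lam • (1 : Matrix (Fin n) (Fin n) ℝ)).det / lam ^ n

/-- The input of SupKMTL-UCB with `N` arms and augmented contexts in `X`. Rounds are numbered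
`0, 1, …, T - 1`. The algorithm leaves open which arm is taken when several qualify; `pick t q S`
is the arm taken in round `t` and stage `q` out of the set `S` of qualifying arms. -/
structure Input (N : ℕ) (X : Type*) where
  k : X → X → ℝ
  lam : ℝ
  c : ℝ
  alpha : ℝ
  T : ℕ
  ctx : ℕ → Fin N → X
  pick : ℕ → ℕ → Finset (Fin N) → Fin N

/-- The memory of the algorithm: the index sets `Ψ^q`, the arms chosen so far and the rewards
observed so far (the entries at rounds that have not been played carry no information). -/
structure State (N : ℕ) where
  Psi : ℕ → Finset ℕ
  arm : ℕ → Fin N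
  rew : ℕ → ℝ

namespace Input

variable {N : ℕ} {X : Type*} (I : Input N X)

/-- The augmented context of the arm chosen in round `τ`. -/
def played (σ : State N) (τ : ℕ) : X := I.ctx τ (σ.arm τ)

/-- The width `w_{a,t} = (α + c √λ) s_{a,t}` computed from `Ψ^q` in round `t`. -/
def w (σ : State N) (t q : ℕ) (a : Fin N) : ℝ :=
  (I.alpha + I.c * √I.lam) * stdWidth I.k I.lam (σ.Psi q) (I.played σ) (I.ctx t a)

/-- The upper confidence bound `ucb_{a,t}` computed from `Ψ^q` in round `t`. -/
def ucb (σ : State N) (t q : ℕ) (a : Fin N) : ℝ :=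
  ridgeEstimate I.k I.lam (σ.Psi q) (I.played σ) σ.rew (I.ctx t a) + I.w σ t q a

open Classical in
/-- The sets of surviving arms: `active σ t j` is `Â_{j+1}`, so that `Â_1` is the set of all arms
and `Â_{q+1} = {a ∈ Â_q | ucb_a ≥ max_{a' ∈ Â_q} ucb_{a'} - 2^{1-q}}`. -/
def active (σ : State N) (t : ℕ) : ℕ → Finset (Fin N)
  | 0 => Finset.univ
  | j + 1 => (active σ t j).filter fun a =>
      ∀ a' ∈ active σ t j, I.ucb σ t (j + 1) a' - 2 / 2 ^ (j + 1) ≤ I.ucb σ t (j + 1) a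

/-- The set `Â_q` of stage `q ≥ 1`. -/
def arms (σ : State N) (t q : ℕ) : Finset (Fin N) := I.active σ t (q - 1)

/-- The test of the first branch: `w_{a,t} ≤ 1/√T` for all `a ∈ Â_q`. -/
def Exploits (σ : State N) (t q : ℕ) : Prop :=
  ∀ a ∈ I.arms σ t q, I.w σ t q a ≤ 1 / √(I.T : ℝ)

/-- The test of the second branch: `w_{a,t} ≤ 2^{-q}` for all `a ∈ Â_q`. -/
def Narrow (σ : State N) (t q : ℕ) : Prop :=
  ∀ a ∈ I.arms σ t q, I.w σ t q a ≤ 1 / 2 ^ q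

/-- The stage at which the inner loop of round `t` ends: the first `q ≥ 1` at which the algorithm
does not take the second branch. -/
def lastStage (σ : State N) (t : ℕ) : ℕ :=
  sInf {q | 1 ≤ q ∧ (I.Exploits σ t q ∨ ¬ I.Narrow σ t q)}

/-- The inner loop terminates. -/
theorem exists_lastStage (hT : 1 ≤ I.T) (σ : State N) (t : ℕ) :
    {q | 1 ≤ q ∧ (I.Exploits σ t q ∨ ¬ I.Narrow σ t q)}.Nonempty := by
  have hpos : (0 : ℝ) < 1 / √(I.T : ℝ) := by
    have : (0 : ℝ) < I.T := by exact_mod_cast hT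
    positivity
  obtain ⟨n, hn⟩ := exists_pow_lt_of_lt_one hpos (by norm_num : (1 / 2 : ℝ) < 1)
  refine ⟨n + 1, by omega, ?_⟩
  by_cases h : I.Exploits σ t (n + 1)
  · exact Or.inl h
  · refine Or.inr fun h' => h fun a ha => (h' a ha).trans (le_trans ?_ hn.le)
    rw [one_div_pow]
    exact one_div_le_one_div_of_le (by positivity)
      (pow_le_pow_right₀ (by norm_num) (Nat.le_succ n))

open Classical in
/-- The arm chosen in round `t`: in the first branch an arm of `Â_q` with maximal `ucb`, in the
third branch an arm of `Â_q` with `w_{a,t} > 2^{-q}`. -/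
def chooseArm (σ : State N) (t : ℕ) : Fin N :=
  let q := I.lastStage σ t
  if I.Exploits σ t q then
    I.pick t q ((I.arms σ t q).filter fun a => ∀ a' ∈ I.arms σ t q, I.ucb σ t q a' ≤ I.ucb σ t q a)
  else
    I.pick t q ((I.arms σ t q).filter fun a => 1 / 2 ^ q < I.w σ t q a)

open Classical in
/-- The index sets after round `t`: the round is added to `Ψ^q` in the third branch only. -/
def nextPsi (σ : State N) (t : ℕ) : ℕ → Finset ℕ :=
  let q := I.lastStage σ t
  if I.Exploits σ t q then σ.Psi else Function.update σ.Psi q (insert t (σ.Psi q))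

/-- SupKMTL-UCB run against the table `r` of rewards (`r t a` is the reward of arm `a` in round
`t`): the state before round `t`. Of the table, only `r τ (a_τ)` for `τ < t` is looked at. -/
def run [NeZero N] (r : ℕ → Fin N → ℝ) : ℕ → State N
  | 0 => { Psi := fun _ => ∅, arm := fun _ => 0, rew := fun _ => 0 }
  | t + 1 =>
    let σ := run r t
    { Psi := I.nextPsi σ t
      arm := Function.update σ.arm t (I.chooseArm σ t)
      rew := Function.update σ.rew t (r t (I.chooseArm σ t)) }

/-- The arm `a_t` chosen by SupKMTL-UCB in round `t`. -/
def armAt [NeZero N] (r : ℕ → Fin N → ℝ) (t : ℕ) : Fin N := I.chooseArm (I.run r t) t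

/-- The `T` trial regret `∑_t v_{b_t,t} - ∑_t v_{a_t,t}` of SupKMTL-UCB against the arms `b_t`,
where the algorithm sees the rewards `r` and the arms are evaluated by `v`. -/
def regret [NeZero N] (r v : ℕ → Fin N → ℝ) (b : ℕ → Fin N) : ℝ :=
  ∑ t ∈ Finset.range I.T, v t (b t) - ∑ t ∈ Finset.range I.T, v t (I.armAt r t)

/-- `g([T]) = det (K̃_{T+1} + λ I) / λ^{T+1}`, where the first `T` points of the kernel matrix are
the augmented contexts of the chosen arms and `x` is the one of round `T + 1`. -/
def g [NeZero N] (r : ℕ → Fin N → ℝ) (x : X) : ℝ :=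
  gainDet I.k I.lam
    (Fin.snoc (α := fun _ => X) (fun t : Fin I.T => I.ctx t (I.armAt r t)) x)

end Input

/-- `α = √(log (2 T N (log T + 1) / δ) / 2)`. -/
def confidence (T N : ℕ) (δ : ℝ) : ℝ :=
  √(Real.log (2 * T * N * (Real.log T + 1) / δ) / 2)

end KMTL

end

/-! Write the kernel as an inner product of features `φ`. The ridge estimate at `x` is linear in the
observed rewards, with weights `b`, and λs² = ‖φ x − ∑ bᵢ φ(pᵢ)‖² + λ ∑ bᵢ²
(`variance_decomposition`). The first summand bounds the bias by c√λ·s, the second gives ∑ bᵢ² ≤ s².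
If the weights did not depend on the rewards, Hoeffding's inequality would bound the noise by αs
outside probability 2exp(−2α²).

The stages supply this independence. Whether a round enters Ψ^q, and with which arm, is decided by
widths of stages up to q, which read no rewards, and by confidence bounds of stages below q. Hence
the event that the history, truncated at stage q, equals a given κ depends only on rewards of rounds
labelled below q (`measurableSet_truncate_hist`), while the noise at stage q involves rounds
labelled q. These rounds are disjoint, so Hoeffding applies on each fibre, and summing over the
countably many κ gives `measure_noiseExceeds_le`.

If all confidence bounds hold, the best arm is never eliminated; an exploiting round costs at most
2/√T and a round added to Ψ^q at most 8 widths (`round_regret_le`). Within a stage each round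
multiplies the normalised determinant by 1 + s² (`gainOn_insert`), so the squared widths of one
stage sum to at most (3/2)·m·log g. Cauchy–Schwarz over at most ⌈(3/4) log T⌉ stages yields the
bound on the expected regret, with 7 in place of 10 (`regret_le_of_good`). The realised regret
differs from it by at most 3α√T, by Azuma–Hoeffding (`measure_regret_deviation_le`); the extra
condition on the determinant absorbs this term, and 7 + 3 = 10. -/

noncomputable section

namespace KMTL

/-! ### Kernel ridge regression: bias, variance and determinants. -/

section Kernel

variable {X H : Type*} [NormedAddCommGroup H] [InnerProductSpace ℝ H] {k : X → X → ℝ} {φ : X → H}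
  {lam : ℝ}

/-- The weights `(K_Ψ + λ I)⁻¹ k_Ψ(x)` of the kernel ridge estimate at `x`. -/
def ridgeWeights (k : X → X → ℝ) (lam : ℝ) (S : Finset ℕ) (p : ℕ → X) (x : X) : S → ℝ :=
  (gram k S p + lam • (1 : Matrix S S ℝ))⁻¹ *ᵥ kernelVec k S p x

/-- `det (K_Ψ + λ I) / λ^|Ψ|`. -/
def gainOn (k : X → X → ℝ) (lam : ℝ) (S : Finset ℕ) (p : ℕ → X) : ℝ :=
  (gram k S p + lam • (1 : Matrix S S ℝ)).det / lam ^ S.card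

lemma posDef_gram_add (hk : ∀ x y, k x y = inner ℝ (φ x) (φ y)) (hlam : 0 < lam)
    (S : Finset ℕ) (p : ℕ → X) : (gram k S p + lam • (1 : Matrix S S ℝ)).PosDef := by
  have h1 : gram k S p = Matrix.gram ℝ (fun i : S => φ (p i)) := by
    ext i j
    simp [gram, Matrix.gram, hk]
  rw [h1]
  exact Matrix.PosDef.posSemidef_add (Matrix.posSemidef_gram ℝ _) (Matrix.PosDef.one.smul hlam)

lemma isUnit_det_gram_add (hk : ∀ x y, k x y = inner ℝ (φ x) (φ y)) (hlam : 0 < lam)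
    (S : Finset ℕ) (p : ℕ → X) : IsUnit (gram k S p + lam • (1 : Matrix S S ℝ)).det :=
  (posDef_gram_add hk hlam S p).det_pos.ne'.isUnit

lemma ridgeEstimate_eq_sum (hk : ∀ x y, k x y = inner ℝ (φ x) (φ y)) (hlam : 0 < lam)
    (S : Finset ℕ) (p : ℕ → X) (y : ℕ → ℝ) (x : X) :
    ridgeEstimate k lam S p y x = ∑ i : S, ridgeWeights k lam S p x i * y i := by
  have hT := (posDef_gram_add hk hlam S p).isHermitian.inv
  rw [Matrix.IsHermitian, Matrix.conjTranspose_eq_transpose_of_trivial] at hT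
  rw [ridgeEstimate, Matrix.dotProduct_mulVec, ← Matrix.mulVec_transpose, hT]
  rfl

lemma gram_add_mulVec_ridgeWeights (hk : ∀ x y, k x y = inner ℝ (φ x) (φ y)) (hlam : 0 < lam)
    (S : Finset ℕ) (p : ℕ → X) (x : X) :
    (gram k S p + lam • (1 : Matrix S S ℝ)) *ᵥ ridgeWeights k lam S p x = kernelVec k S p x := by
  rw [ridgeWeights, Matrix.mulVec_mulVec,
    Matrix.mul_nonsing_inv _ (isUnit_det_gram_add hk hlam S p), Matrix.one_mulVec]

lemma dotProduct_ridgeWeights (hk : ∀ x y, k x y = inner ℝ (φ x) (φ y)) (hlam : 0 < lam)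
    (S : Finset ℕ) (p : ℕ → X) (x : X) :
    kernelVec k S p x ⬝ᵥ ridgeWeights k lam S p x =
      ‖∑ i : S, ridgeWeights k lam S p x i • φ (p i)‖ ^ 2 +
        lam * ∑ i : S, ridgeWeights k lam S p x i ^ 2 := by
  rw [← gram_add_mulVec_ridgeWeights hk hlam S p x]
  set b := ridgeWeights k lam S p x
  rw [Matrix.add_mulVec, add_dotProduct, Matrix.smul_mulVec, Matrix.one_mulVec, smul_dotProduct,
    ← real_inner_self_eq_norm_sq, sum_inner]
  congr 1
  · simp only [dotProduct, Matrix.mulVec, inner_sum, inner_smul_left, inner_smul_right, gram,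
      Matrix.of_apply, hk]
    refine Finset.sum_congr rfl fun i _ => ?_
    rw [Finset.sum_mul]
    refine Finset.sum_congr rfl fun j _ => ?_
    simp
    ring
  · simp [dotProduct, sq]

/-- The decomposition of the posterior variance into a bias and a noise part. -/
lemma variance_decomposition (hk : ∀ x y, k x y = inner ℝ (φ x) (φ y)) (hlam : 0 < lam)
    (S : Finset ℕ) (p : ℕ → X) (x : X) :
    k x x - kernelVec k S p x ⬝ᵥ ridgeWeights k lam S p x =
      ‖φ x - ∑ i : S, ridgeWeights k lam S p x i • φ (p i)‖ ^ 2 +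
        lam * ∑ i : S, ridgeWeights k lam S p x i ^ 2 := by
  have h1 := dotProduct_ridgeWeights hk hlam S p x
  have h2 : inner ℝ (φ x) (∑ i : S, ridgeWeights k lam S p x i • φ (p i)) =
      kernelVec k S p x ⬝ᵥ ridgeWeights k lam S p x := by
    simp only [inner_sum, inner_smul_right, dotProduct, kernelVec, hk]
    exact Finset.sum_congr rfl fun i _ => mul_comm _ _
  rw [norm_sub_sq_real, h2, hk x x, real_inner_self_eq_norm_sq]
  linarith

lemma lam_mul_stdWidth_sq (hk : ∀ x y, k x y = inner ℝ (φ x) (φ y)) (hlam : 0 < lam)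
    (S : Finset ℕ) (p : ℕ → X) (x : X) :
    lam * stdWidth k lam S p x ^ 2 =
      k x x - kernelVec k S p x ⬝ᵥ ridgeWeights k lam S p x := by
  have h := variance_decomposition hk hlam S p x
  have h0 : 0 ≤ k x x - kernelVec k S p x ⬝ᵥ ridgeWeights k lam S p x := by
    rw [h]; positivity
  rw [stdWidth, ← ridgeWeights, mul_pow, inv_pow, Real.sq_sqrt hlam.le, Real.sq_sqrt h0,
    ← mul_assoc, mul_inv_cancel₀ hlam.ne', one_mul]

lemma stdWidth_nonneg (k : X → X → ℝ) (lam : ℝ) (S : Finset ℕ) (p : ℕ → X) (x : X) :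
    0 ≤ stdWidth k lam S p x := by
  unfold stdWidth
  positivity

/-- Drop the bias part of the variance decomposition. This makes s the right scale for the noise in
Hoeffding's inequality. -/
lemma sum_ridgeWeights_sq_le (hk : ∀ x y, k x y = inner ℝ (φ x) (φ y)) (hlam : 0 < lam)
    (S : Finset ℕ) (p : ℕ → X) (x : X) :
    ∑ i : S, ridgeWeights k lam S p x i ^ 2 ≤ stdWidth k lam S p x ^ 2 := by
  have h1 := lam_mul_stdWidth_sq hk hlam S p x
  rw [variance_decomposition hk hlam S p x] at h1
  refine le_of_mul_le_mul_left ?_ hlam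
  rw [h1]
  exact le_add_of_nonneg_left (by positivity)

lemma stdWidth_sq_le (hk : ∀ x y, k x y = inner ℝ (φ x) (φ y)) (hlam : 0 < lam)
    (S : Finset ℕ) (p : ℕ → X) (x : X) :
    stdWidth k lam S p x ^ 2 ≤ k x x / lam := by
  rw [le_div_iff₀ hlam, mul_comm, lam_mul_stdWidth_sq hk hlam, dotProduct_ridgeWeights hk hlam]
  refine sub_le_self _ ?_
  positivity

/-- The bias of the kernel ridge estimate of an element of the feature space. -/
lemma abs_ridgeWeights_bias_le (hk : ∀ x y, k x y = inner ℝ (φ x) (φ y)) (hlam : 0 < lam)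
    (S : Finset ℕ) (p : ℕ → X) (x : X) (f : H) {c : ℝ} (hf : ‖f‖ ≤ c) :
    |∑ i : S, ridgeWeights k lam S p x i * inner ℝ f (φ (p i)) - inner ℝ f (φ x)| ≤
      c * √lam * stdWidth k lam S p x := by
  have h1 := lam_mul_stdWidth_sq hk hlam S p x
  rw [variance_decomposition hk hlam S p x] at h1
  -- Here the noise part of the decomposition is dropped instead; Cauchy–Schwarz against `f` then
  -- finishes.
  have h2 : ‖φ x - ∑ i : S, ridgeWeights k lam S p x i • φ (p i)‖ ≤
      √lam * stdWidth k lam S p x := by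
    refine le_of_sq_le_sq ?_ (by have := stdWidth_nonneg k lam S p x; positivity)
    rw [mul_pow, Real.sq_sqrt hlam.le, h1]
    exact le_add_of_nonneg_right (by positivity)
  have h3 : ∑ i : S, ridgeWeights k lam S p x i * inner ℝ f (φ (p i)) - inner ℝ f (φ x) =
      - inner ℝ f (φ x - ∑ i : S, ridgeWeights k lam S p x i • φ (p i)) := by
    simp [inner_sub_right, inner_sum, inner_smul_right]
  rw [h3, abs_neg, mul_assoc]
  exact (abs_real_inner_le_norm _ _).trans
    (mul_le_mul hf h2 (norm_nonneg _) ((norm_nonneg f).trans hf))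

lemma gainOn_pos (hk : ∀ x y, k x y = inner ℝ (φ x) (φ y)) (hlam : 0 < lam)
    (S : Finset ℕ) (p : ℕ → X) : 0 < gainOn k lam S p :=
  div_pos (posDef_gram_add hk hlam S p).det_pos (pow_pos hlam _)

lemma gainOn_empty (p : ℕ → X) : gainOn k lam ∅ p = 1 := by
  simp [gainOn]

/-- Adding a point multiplies the determinant by `1 + s²`. -/
lemma gainOn_insert (hk : ∀ x y, k x y = inner ℝ (φ x) (φ y)) (hlam : 0 < lam)
    {S : Finset ℕ} (p : ℕ → X) {a : ℕ} (ha : a ∉ S) :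
    gainOn k lam (insert a S) p = gainOn k lam S p * (1 + stdWidth k lam S p (p a) ^ 2) := by
  have hsymm : ∀ x y, k x y = k y x := fun x y => by rw [hk, hk, real_inner_comm]
  have hlam' := hlam.ne'
  -- Put the new index last, so that the matrix has blocks and its determinant factors through the
  -- Schur complement λ(1 + s²).
  let e : S ⊕ Unit ≃ (insert a S : Finset ℕ) :=
    (Equiv.optionEquivSumPUnit S).symm.trans (Finset.subtypeInsertEquivOption ha).symm
  have e1 : ∀ i : S, ((e (Sum.inl i) : (insert a S : Finset ℕ)) : ℕ) = i := fun i => by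
    simp [e, Finset.subtypeInsertEquivOption]
  have e2 : ((e (Sum.inr ()) : (insert a S : Finset ℕ)) : ℕ) = a := by
    simp [e, Finset.subtypeInsertEquivOption]
  have hM : (gram k (insert a S) p + lam • (1 : Matrix (insert a S : Finset ℕ) _ ℝ)).submatrix e e =
      Matrix.fromBlocks (gram k S p + lam • (1 : Matrix S S ℝ))
        (Matrix.of fun i _ => kernelVec k S p (p a) i)
        (Matrix.of fun _ i => kernelVec k S p (p a) i)
        (Matrix.of fun _ _ : Unit => k (p a) (p a) + lam) := by
    ext i j
    rcases i with i | i <;> rcases j with j | j <;>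
      simp [gram, kernelVec, e1, e2, Matrix.one_apply, hsymm]
  have hA := isUnit_det_gram_add hk hlam S p
  let _ := Matrix.invertibleOfIsUnitDet _ hA
  rw [gainOn, ← Matrix.det_submatrix_equiv_self e, hM, Matrix.det_fromBlocks₁₁,
    Finset.card_insert_of_notMem ha, Matrix.det_unique (n := Unit), Matrix.invOf_eq_nonsing_inv]
  have h3 : (Matrix.of (fun _ _ : Unit => k (p a) (p a) + lam) -
      (Matrix.of fun (_ : Unit) i => kernelVec k S p (p a) i) *
        (gram k S p + lam • (1 : Matrix S S ℝ))⁻¹ *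
        (Matrix.of fun i (_ : Unit) => kernelVec k S p (p a) i)) default default =
      lam * (1 + stdWidth k lam S p (p a) ^ 2) := by
    rw [mul_add, lam_mul_stdWidth_sq hk hlam, Matrix.sub_apply, Matrix.mul_assoc]
    simp [Matrix.mul_apply, ridgeWeights, dotProduct, Matrix.mulVec]
    ring
  rw [h3, gainOn]
  field_simp
  ring

/-- Each added point contributes a factor 1 + s² ≥ 1. This lets the points of one stage be compared
with all T + 1 points. -/
lemma gainOn_mono (hk : ∀ x y, k x y = inner ℝ (φ x) (φ y)) (hlam : 0 < lam)
    {S S' : Finset ℕ} (h : S ⊆ S') (p : ℕ → X) : gainOn k lam S p ≤ gainOn k lam S' p := by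
  induction S' using Finset.strongInduction generalizing S with
  | H S' ih =>
    rcases eq_or_ne S S' with rfl | hne
    · exact le_rfl
    · obtain ⟨a, ha, haS⟩ := Finset.exists_of_ssubset (h.ssubset_of_ne hne)
      have h1 := ih (S'.erase a) (Finset.erase_ssubset ha) (S := S)
        (fun b hb => Finset.mem_erase.2 ⟨fun hab => haS (hab ▸ hb), h hb⟩)
      have h2 := gainOn_insert hk hlam p (Finset.notMem_erase a S')
      rw [Finset.insert_erase ha] at h2
      rw [h2]
      exact h1.trans (le_mul_of_one_le_right (gainOn_pos hk hlam _ _).le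
        (le_add_of_nonneg_right (sq_nonneg _)))

lemma gainDet_eq_gainOn (p : ℕ → X) (n : ℕ) :
    gainDet k lam (fun i : Fin n => p i) = gainOn k lam (Finset.range n) p := by
  let e : Fin n ≃ Finset.range n :=
    { toFun := fun i => ⟨i, Finset.mem_range.2 i.2⟩
      invFun := fun i => ⟨i, Finset.mem_range.1 i.2⟩
      left_inv := fun _ => rfl
      right_inv := fun _ => rfl }
  rw [gainDet, gainOn, ← Matrix.det_submatrix_equiv_self e, Finset.card_range]
  congr 2
  ext i j
  simp [gram, e, Matrix.one_apply, Fin.ext_iff]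

lemma gram_congr (k : X → X → ℝ) {S : Finset ℕ} {p p' : ℕ → X} (h : ∀ i ∈ S, p i = p' i) :
    gram k S p = gram k S p' := by
  ext i j
  simp [gram, h i i.2, h j j.2]

lemma kernelVec_congr (k : X → X → ℝ) {S : Finset ℕ} {p p' : ℕ → X} (h : ∀ i ∈ S, p i = p' i)
    (x : X) : kernelVec k S p x = kernelVec k S p' x := by
  ext i
  simp [kernelVec, h i i.2]

lemma stdWidth_congr (k : X → X → ℝ) (lam : ℝ) {S : Finset ℕ} {p p' : ℕ → X}
    (h : ∀ i ∈ S, p i = p' i) (x : X) : stdWidth k lam S p x = stdWidth k lam S p' x := by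
  rw [stdWidth, stdWidth, gram_congr k h, kernelVec_congr k h]

lemma ridgeWeights_congr (k : X → X → ℝ) (lam : ℝ) {S : Finset ℕ} {p p' : ℕ → X}
    (h : ∀ i ∈ S, p i = p' i) (x : X) : ridgeWeights k lam S p x = ridgeWeights k lam S p' x := by
  rw [ridgeWeights, ridgeWeights, gram_congr k h, kernelVec_congr k h]

lemma ridgeEstimate_congr (k : X → X → ℝ) (lam : ℝ) {S : Finset ℕ} {p p' : ℕ → X}
    {y y' : ℕ → ℝ} (h : ∀ i ∈ S, p i = p' i) (hy : ∀ i ∈ S, y i = y' i) (x : X) :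
    ridgeEstimate k lam S p y x = ridgeEstimate k lam S p' y' x := by
  have : (fun i : S => y i) = fun i : S => y' i := funext fun i => hy i i.2
  rw [ridgeEstimate, ridgeEstimate, gram_congr k h, kernelVec_congr k h, this]

lemma gainOn_congr (k : X → X → ℝ) (lam : ℝ) {S : Finset ℕ} {p p' : ℕ → X}
    (h : ∀ i ∈ S, p i = p' i) : gainOn k lam S p = gainOn k lam S p' := by
  rw [gainOn, gainOn, gram_congr k h]

end Kernel

lemma measurable_ridgeEstimate {X : Type*} (k : X → X → ℝ) (lam : ℝ) (S : Finset ℕ) (p : ℕ → X)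
    (x : X) : Measurable fun y : ℕ → ℝ => ridgeEstimate k lam S p y x := by
  have hy : ∀ j : ℕ, Measurable fun y : ℕ → ℝ => y j := fun j => measurable_pi_apply j
  simp only [ridgeEstimate, dotProduct, Matrix.mulVec]
  refine Finset.measurable_sum _ fun i _ => Measurable.const_mul ?_ _
  refine Finset.measurable_sum _ fun j _ => Measurable.const_mul ?_ _
  exact hy j

/-! ### The run of the algorithm as a function of its history. -/

namespace Input

variable {N : ℕ} {X : Type*} (I : Input N X)

open Classical in
/-- The stage to whose index set round `t` is added, and `0` if it is added to none. -/
def stageLabel (σ : State N) (t : ℕ) : ℕ :=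
  if I.Exploits σ t (I.lastStage σ t) then 0 else I.lastStage σ t

/-- The outcome of round `t`: its label and the chosen arm. -/
def decision (σ : State N) (t : ℕ) : ℕ × Fin N := (I.stageLabel σ t, I.chooseArm σ t)

/-- The outcome of round `t` if the algorithm is run against the table `r`. -/
def hist [NeZero N] (r : ℕ → Fin N → ℝ) (t : ℕ) : ℕ × Fin N := I.decision (I.run r t) t

/-- The state before round `t` that belongs to the outcomes `κ` and the rewards `r` of the earlier
rounds. -/
def ofHist [NeZero N] (κ : ℕ → ℕ × Fin N) (r : ℕ → Fin N → ℝ) (t : ℕ) : State N where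
  Psi q := (Finset.range t).filter fun τ => (κ τ).1 = q ∧ q ≠ 0
  arm τ := if τ < t then (κ τ).2 else 0
  rew τ := if τ < t then r τ (κ τ).2 else 0

lemma lastStage_mem (hT : 1 ≤ I.T) (σ : State N) (t : ℕ) :
    1 ≤ I.lastStage σ t ∧
      (I.Exploits σ t (I.lastStage σ t) ∨ ¬ I.Narrow σ t (I.lastStage σ t)) :=
  Nat.sInf_mem (I.exists_lastStage hT σ t)

lemma not_exploits_and_narrow_of_lt_lastStage {σ : State N} {t q : ℕ} (hq : 1 ≤ q)
    (h : q < I.lastStage σ t) : ¬ I.Exploits σ t q ∧ I.Narrow σ t q := by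
  have h1 := Nat.notMem_of_lt_sInf h
  simp only [Set.mem_ofPred_eq, hq, true_and, not_or, not_not] at h1
  exact h1

/-- Replaces the infimum by countably many conditions on the tests, as needed for measurability. -/
lemma lastStage_eq_iff (hT : 1 ≤ I.T) (σ : State N) (t q : ℕ) :
    I.lastStage σ t = q ↔ (1 ≤ q ∧ (I.Exploits σ t q ∨ ¬ I.Narrow σ t q)) ∧
      ∀ q' < q, ¬ (1 ≤ q' ∧ (I.Exploits σ t q' ∨ ¬ I.Narrow σ t q')) := by
  constructor
  · rintro rfl
    exact ⟨I.lastStage_mem hT σ t, fun q' hq' => Nat.notMem_of_lt_sInf hq'⟩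
  · rintro ⟨h1, h2⟩
    refine le_antisymm (Nat.sInf_le h1) ?_
    by_contra h
    exact h2 _ (not_le.1 h) (I.lastStage_mem hT σ t)

section Run

variable [NeZero N]

lemma ofHist_Psi_subset (κ : ℕ → ℕ × Fin N) (r : ℕ → Fin N → ℝ) (t q : ℕ) :
    (ofHist κ r t).Psi q ⊆ Finset.range t := Finset.filter_subset _ _

/-- The memory is a function of past labels, arms and rewards. Once labels and arms are frozen, the
index sets and the chosen contexts are deterministic. -/
lemma run_eq_ofHist (hT : 1 ≤ I.T) (r : ℕ → Fin N → ℝ) (t : ℕ) :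
    I.run r t = ofHist (I.hist r) r t := by
  induction t with
  | zero => simp [run, ofHist]
  | succ t ih =>
    have hl : (I.hist r t).1 = I.stageLabel (I.run r t) t := rfl
    have ha : (I.hist r t).2 = I.chooseArm (I.run r t) t := rfl
    have h1 := (I.lastStage_mem hT (I.run r t) t).1
    rw [run]
    simp only [ofHist, State.mk.injEq]
    refine ⟨?_, ?_, ?_⟩
    · funext q
      have hP : (I.run r t).Psi = fun q =>
          (Finset.range t).filter fun τ => (I.hist r τ).1 = q ∧ q ≠ 0 := by rw [ih]; rfl
      rw [Finset.range_add_one, Finset.filter_insert, hl, stageLabel, nextPsi]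
      by_cases hE : I.Exploits (I.run r t) t (I.lastStage (I.run r t) t)
      · simp only [hE, if_true]
        rw [if_neg (by tauto), hP]
      · simp only [hE, if_false]
        by_cases hq : q = I.lastStage (I.run r t) t
        · rw [hq, Function.update_self, if_pos ⟨rfl, by omega⟩]
          congr 1
          rw [hP]
        · rw [Function.update_of_ne hq, if_neg (by tauto), hP]
    · funext τ
      have hA : (I.run r t).arm = fun τ => if τ < t then (I.hist r τ).2 else 0 := by rw [ih]; rfl
      rcases lt_trichotomy τ t with h | h | h
      · rw [Function.update_of_ne h.ne, hA]
        simp [h, h.trans (Nat.lt_succ_self t)]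
      · subst h
        simp [ha]
      · rw [Function.update_of_ne h.ne', hA]
        simp [h.not_gt, show ¬ τ < t + 1 by omega]
    · funext τ
      have hA : (I.run r t).rew = fun τ => if τ < t then r τ (I.hist r τ).2 else 0 := by
        rw [ih]; rfl
      rcases lt_trichotomy τ t with h | h | h
      · rw [Function.update_of_ne h.ne, hA]
        simp [h, h.trans (Nat.lt_succ_self t)]
      · subst h
        simp [ha]
      · rw [Function.update_of_ne h.ne', hA]
        simp [h.not_gt, show ¬ τ < t + 1 by omega]

lemma hist_snd (r : ℕ → Fin N → ℝ) (t : ℕ) : (I.hist r t).2 = I.armAt r t := rfl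

lemma mem_run_Psi (hT : 1 ≤ I.T) (r : ℕ → Fin N → ℝ) {t q τ : ℕ} (hq : 1 ≤ q) :
    τ ∈ (I.run r t).Psi q ↔ τ < t ∧ (I.hist r τ).1 = q := by
  rw [I.run_eq_ofHist hT]
  simp [ofHist, show q ≠ 0 by omega]

lemma run_arm (hT : 1 ≤ I.T) (r : ℕ → Fin N → ℝ) {t τ : ℕ} (h : τ < t) :
    (I.run r t).arm τ = I.armAt r τ := by
  rw [I.run_eq_ofHist hT]
  simp [ofHist, h, hist_snd]

lemma run_rew (hT : 1 ≤ I.T) (r : ℕ → Fin N → ℝ) {t τ : ℕ} (h : τ < t) :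
    (I.run r t).rew τ = r τ (I.armAt r τ) := by
  rw [I.run_eq_ofHist hT]
  simp [ofHist, h, hist_snd]

lemma played_run (hT : 1 ≤ I.T) (r : ℕ → Fin N → ℝ) {t τ : ℕ} (h : τ < t) :
    I.played (I.run r t) τ = I.ctx τ (I.armAt r τ) := by
  rw [played, I.run_arm hT r h]

end Run

/-! ### Stage q does not depend on the rewards of stage q. -/

section Agreement

/-- The states agree on the stages up to `q`, except for the rewards of stage `q`. -/
structure AgreeUpTo (q : ℕ) (σ σ' : State N) : Prop where
  Psi_eq : ∀ j, 1 ≤ j → j ≤ q → σ.Psi j = σ'.Psi j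
  arm_eq : ∀ j, 1 ≤ j → j ≤ q → ∀ τ ∈ σ.Psi j, σ.arm τ = σ'.arm τ
  rew_eq : ∀ j, 1 ≤ j → j < q → ∀ τ ∈ σ.Psi j, σ.rew τ = σ'.rew τ

variable {I} {q : ℕ} {σ σ' : State N}

lemma AgreeUpTo.w_eq (h : AgreeUpTo q σ σ') (t : ℕ) {j : ℕ} (h1 : 1 ≤ j) (hj : j ≤ q)
    (a : Fin N) : I.w σ t j a = I.w σ' t j a := by
  rw [w, w, ← h.Psi_eq j h1 hj]
  congr 1
  refine stdWidth_congr _ _ (fun i hi => ?_) _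
  rw [played, played, h.arm_eq j h1 hj i hi]

lemma AgreeUpTo.ucb_eq (h : AgreeUpTo q σ σ') (t : ℕ) {j : ℕ} (h1 : 1 ≤ j) (hj : j < q)
    (a : Fin N) : I.ucb σ t j a = I.ucb σ' t j a := by
  rw [ucb, ucb, h.w_eq t h1 hj.le, ← h.Psi_eq j h1 hj.le]
  congr 1
  refine ridgeEstimate_congr _ _ (fun i hi => ?_) (h.rew_eq j h1 hj) _
  rw [played, played, h.arm_eq j h1 hj.le i hi]

/-- The set used at stage j + 1 is formed from confidence bounds of stages at most j, so agreement
of rewards below q suffices. -/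
lemma AgreeUpTo.active_eq (h : AgreeUpTo q σ σ') (t : ℕ) {j : ℕ} (hj : j < q) :
    I.active σ t j = I.active σ' t j := by
  induction j with
  | zero => rfl
  | succ j ih =>
    rw [active, active, ih (by omega)]
    ext a
    simp only [Finset.mem_filter, h.ucb_eq t (Nat.le_add_left 1 j) hj]

lemma AgreeUpTo.arms_eq (h : AgreeUpTo q σ σ') (t : ℕ) {j : ℕ} (h1 : 1 ≤ j) (hj : j ≤ q) :
    I.arms σ t j = I.arms σ' t j :=
  h.active_eq t (by omega)

lemma AgreeUpTo.exploits_iff (h : AgreeUpTo q σ σ') (t : ℕ) {j : ℕ} (h1 : 1 ≤ j) (hj : j ≤ q) :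
    I.Exploits σ t j ↔ I.Exploits σ' t j := by
  simp only [Exploits, h.arms_eq t h1 hj, h.w_eq t h1 hj]

lemma AgreeUpTo.narrow_iff (h : AgreeUpTo q σ σ') (t : ℕ) {j : ℕ} (h1 : 1 ≤ j) (hj : j ≤ q) :
    I.Narrow σ t j ↔ I.Narrow σ' t j := by
  simp only [Narrow, h.arms_eq t h1 hj, h.w_eq t h1 hj]

lemma AgreeUpTo.symm (h : AgreeUpTo q σ σ') : AgreeUpTo q σ' σ where
  Psi_eq j h1 hj := (h.Psi_eq j h1 hj).symm
  arm_eq j h1 hj τ hτ := (h.arm_eq j h1 hj τ (h.Psi_eq j h1 hj ▸ hτ)).symm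
  rew_eq j h1 hj τ hτ := (h.rew_eq j h1 hj τ (h.Psi_eq j h1 hj.le ▸ hτ)).symm

lemma AgreeUpTo.lastStage_le (hT : 1 ≤ I.T) (h : AgreeUpTo q σ σ') (t : ℕ)
    (hq : I.lastStage σ t ≤ q) : I.lastStage σ' t ≤ I.lastStage σ t := by
  have h1 := I.lastStage_mem hT σ t
  refine Nat.sInf_le ⟨h1.1, ?_⟩
  rw [← h.exploits_iff t h1.1 hq, ← h.narrow_iff t h1.1 hq]
  exact h1.2

lemma AgreeUpTo.lastStage_eq (hT : 1 ≤ I.T) (h : AgreeUpTo q σ σ') (t : ℕ)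
    (hq : I.lastStage σ t ≤ q) : I.lastStage σ' t = I.lastStage σ t :=
  le_antisymm (h.lastStage_le hT t hq)
    (h.symm.lastStage_le hT t ((h.lastStage_le hT t hq).trans hq))

/-- The outcome of a round as far as the stages up to `q` are concerned. -/
def truncate [NeZero N] (q : ℕ) (d : ℕ × Fin N) : ℕ × Fin N :=
  -- Exploiting rounds and rounds of later stages are identified. Their arm is erased too, because
  -- it may depend on rewards of stage q or beyond.
  if 1 ≤ d.1 ∧ d.1 ≤ q then d else (0, 0)

lemma AgreeUpTo.truncate_decision_of_le [NeZero N] (hT : 1 ≤ I.T) (h : AgreeUpTo q σ σ') (t : ℕ)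
    (hq : I.lastStage σ t ≤ q) :
    truncate q (I.decision σ t) = truncate q (I.decision σ' t) := by
  have h1 := (I.lastStage_mem hT σ t).1
  have he := h.lastStage_eq hT t hq
  have hE := h.exploits_iff (I := I) t h1 hq
  -- An exploiting round picks its arm by confidence bounds, possibly those of stage q, but its
  -- label 0 makes truncation forget the arm. Otherwise the arm is picked by widths alone.
  by_cases hx : I.Exploits σ t (I.lastStage σ t)
  · have hx' := hE.1 hx
    simp [truncate, decision, stageLabel, he, hx, hx']
  · have hx' : ¬ I.Exploits σ' t (I.lastStage σ' t) := fun hx' => hx (hE.2 (he ▸ hx'))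
    have hd : I.decision σ t = I.decision σ' t := by
      simp only [decision, stageLabel, chooseArm, hx, if_false, he, h.arms_eq t h1 hq,
        h.w_eq t h1 hq]
      rw [if_neg hx', if_neg hx']
    rw [hd]

lemma AgreeUpTo.truncate_decision [NeZero N] (hT : 1 ≤ I.T) (h : AgreeUpTo q σ σ') (t : ℕ) :
    truncate q (I.decision σ t) = truncate q (I.decision σ' t) := by
  by_cases hq : I.lastStage σ t ≤ q
  · exact h.truncate_decision_of_le hT t hq
  by_cases hq' : I.lastStage σ' t ≤ q
  · exact (h.symm.truncate_decision_of_le hT t hq').symm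
  -- If both runs pass stage q, both outcomes truncate to the default, wherever the loops end.
  have aux : ∀ σ : State N, ¬ I.lastStage σ t ≤ q → truncate q (I.decision σ t) = (0, 0) := by
    intro σ hσ
    refine if_neg ?_
    simp only [decision, stageLabel]
    split_ifs
    · simp
    · exact fun h' => hσ h'.2
  rw [aux σ' hq', aux σ hq]

/-- The table `r`, with the entries blanked that the stages below `q` of the outcomes `κ` do not
look at. -/
def maskRewards (q : ℕ) (κ : ℕ → ℕ × Fin N) (r : ℕ → Fin N → ℝ) (τ : ℕ) (a : Fin N) : ℝ :=
  if 1 ≤ (κ τ).1 ∧ (κ τ).1 < q then r τ a else 0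

lemma truncate_eq_of_fst [NeZero N] {d e : ℕ × Fin N} (h : truncate q d = e) {j : ℕ} (h1 : 1 ≤ j)
    (hj : j ≤ q) : (d.1 = j ↔ e.1 = j) ∧ (e.1 = j → d = e) := by
  unfold truncate at h
  split_ifs at h with hd
  · subst h
    simp
  · subst h
    simp only
    constructor
    · omega
    · omega

lemma agreeUpTo_ofHist [NeZero N] {κ κ' : ℕ → ℕ × Fin N} (r : ℕ → Fin N → ℝ) {t : ℕ}
    (h : ∀ τ < t, truncate q (κ τ) = κ' τ) :
    AgreeUpTo q (ofHist κ r t) (ofHist κ' (maskRewards q κ' r) t) where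
  Psi_eq j h1 hj := by
    ext τ
    simp only [ofHist, Finset.mem_filter, Finset.mem_range]
    refine and_congr_right fun hτ => ?_
    rw [(truncate_eq_of_fst (h τ hτ) h1 hj).1]
  arm_eq j h1 hj τ hτ := by
    simp only [ofHist, Finset.mem_filter, Finset.mem_range] at hτ
    have h2 := truncate_eq_of_fst (h τ hτ.1) h1 hj
    simp only [ofHist, hτ.1, if_true]
    rw [h2.2 (h2.1.1 hτ.2.1)]
  rew_eq j h1 hj τ hτ := by
    simp only [ofHist, Finset.mem_filter, Finset.mem_range] at hτ
    have h2 := truncate_eq_of_fst (h τ hτ.1) h1 hj.le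
    have h3 := h2.1.1 hτ.2.1
    simp only [ofHist, hτ.1, if_true, maskRewards]
    rw [h2.2 h3, if_pos (by omega)]

/-- As far as the stages up to `q` are concerned, the outcome of a round is determined by the
earlier outcomes and the rewards at stages below `q`. -/
lemma truncate_hist [NeZero N] (hT : 1 ≤ I.T) (r : ℕ → Fin N → ℝ) {κ : ℕ → ℕ × Fin N} {t : ℕ}
    (h : ∀ τ < t, truncate q (I.hist r τ) = κ τ) :
    truncate q (I.hist r t) =
      truncate q (I.decision (ofHist κ (maskRewards q κ r) t) t) := by
  rw [hist, I.run_eq_ofHist hT]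
  exact (agreeUpTo_ofHist r h).truncate_decision hT t

/-- The noise in the estimate of arm `a` at stage `q` exceeds `α` standard widths. -/
def NoiseExceeds (I : Input N X) (σ : State N) (y v : ℕ → Fin N → ℝ) (α : ℝ) (t q : ℕ)
    (a : Fin N) : Prop :=
  α * stdWidth I.k I.lam (σ.Psi q) (I.played σ) (I.ctx t a) <
    |∑ i : σ.Psi q, ridgeWeights I.k I.lam (σ.Psi q) (I.played σ) (I.ctx t a) i *
      (y i (σ.arm i) - v i (σ.arm i))|

lemma noiseExceeds_congr {σ σ' : State N} {q : ℕ} (hPsi : σ.Psi q = σ'.Psi q)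
    (harm : ∀ τ ∈ σ.Psi q, σ.arm τ = σ'.arm τ) {y v : ℕ → Fin N → ℝ} {α : ℝ} {t : ℕ} {a : Fin N}
    (h : I.NoiseExceeds σ y v α t q a) : I.NoiseExceeds σ' y v α t q a := by
  have hp : ∀ τ ∈ σ.Psi q, I.played σ τ = I.played σ' τ := fun τ hτ => by
    rw [played, played, harm τ hτ]
  have hs : ∀ i : σ.Psi q, y i (σ.arm i) - v i (σ.arm i) = y i (σ'.arm i) - v i (σ'.arm i) :=
    fun i => by rw [harm i i.2]
  unfold NoiseExceeds at h ⊢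
  rw [stdWidth_congr _ _ hp, ridgeWeights_congr _ _ hp] at h
  simp only [hs] at h
  rwa [← hPsi]

end Agreement

/-! ### Measurability of one round in the observed rewards. -/

section Measurability

variable (Psi : ℕ → Finset ℕ) (arm : ℕ → Fin N) (t : ℕ)

lemma measurable_w (q : ℕ) (a : Fin N) :
    Measurable fun y : ℕ → ℝ => I.w ⟨Psi, arm, y⟩ t q a := by
  -- The width ignores the rewards, so it is constant in `y`.
  change Measurable fun _ : ℕ → ℝ => I.w ⟨Psi, arm, 0⟩ t q a
  exact measurable_const

lemma measurable_ucb (q : ℕ) (a : Fin N) :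
    Measurable fun y : ℕ → ℝ => I.ucb ⟨Psi, arm, y⟩ t q a :=
  (measurable_ridgeEstimate I.k I.lam (Psi q) (fun τ => I.ctx τ (arm τ)) (I.ctx t a)).add
    (I.measurable_w Psi arm t q a)

lemma measurable_mem_active (j : ℕ) (a : Fin N) :
    Measurable fun y : ℕ → ℝ => a ∈ I.active ⟨Psi, arm, y⟩ t j := by
  induction j generalizing a with
  | zero => simp [active]
  | succ j ih =>
    simp only [active, Finset.mem_filter]
    refine (ih a).and (Measurable.forall fun a' => (ih a').imp ?_)
    exact measurableSet_setOfPred.1 (measurableSet_le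
      ((I.measurable_ucb Psi arm t (j + 1) a').sub_const _) (I.measurable_ucb Psi arm t (j + 1) a))

lemma measurable_exploits (q : ℕ) :
    Measurable fun y : ℕ → ℝ => I.Exploits ⟨Psi, arm, y⟩ t q :=
  Measurable.forall fun a => (I.measurable_mem_active Psi arm t (q - 1) a).imp
    (measurableSet_setOfPred.1 (measurableSet_le (I.measurable_w Psi arm t q a) measurable_const))

lemma measurable_narrow (q : ℕ) :
    Measurable fun y : ℕ → ℝ => I.Narrow ⟨Psi, arm, y⟩ t q :=
  Measurable.forall fun a => (I.measurable_mem_active Psi arm t (q - 1) a).imp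
    (measurableSet_setOfPred.1 (measurableSet_le (I.measurable_w Psi arm t q a) measurable_const))

lemma measurable_lastStage_eq (hT : 1 ≤ I.T) (q : ℕ) :
    Measurable fun y : ℕ → ℝ => I.lastStage ⟨Psi, arm, y⟩ t = q := by
  simp only [I.lastStage_eq_iff hT]
  have h : ∀ q, Measurable fun y : ℕ → ℝ => 1 ≤ q ∧
      (I.Exploits ⟨Psi, arm, y⟩ t q ∨ ¬ I.Narrow ⟨Psi, arm, y⟩ t q) := fun q =>
    measurable_const.and
      ((I.measurable_exploits Psi arm t q).or (I.measurable_narrow Psi arm t q).not)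
  exact (h q).and (Measurable.forall fun q' => measurable_const.imp (h q').not)

/-- There are finitely many sets of arms, so one may split over the value of `F`; nothing is
required of the rule `g`. -/
lemma measurable_pick_eq {Y : Type*} [MeasurableSpace Y] {F : Y → Finset (Fin N)}
    (hF : ∀ a, Measurable fun y => a ∈ F y) (g : Finset (Fin N) → Fin N) (a : Fin N) :
    Measurable fun y => g (F y) = a := by
  have h : (fun y => g (F y) = a) = fun y => ∃ S, (∀ b, b ∈ F y ↔ b ∈ S) ∧ g S = a := by
    funext y
    refine propext ⟨fun h => ⟨F y, fun b => Iff.rfl, h⟩, ?_⟩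
    rintro ⟨S, hS, h⟩
    rwa [Finset.ext hS]
  rw [h]
  exact Measurable.exists fun S =>
    (Measurable.forall fun b => (hF b).iff measurable_const).and measurable_const

lemma measurable_decision (hT : 1 ≤ I.T) :
    Measurable fun y : ℕ → ℝ => I.decision ⟨Psi, arm, y⟩ t := by
  classical
  refine measurable_to_countable' fun d => measurableSet_setOfPred.2 ?_
  have h : (fun y : ℕ → ℝ => I.decision ⟨Psi, arm, y⟩ t ∈ ({d} : Set (ℕ × Fin N))) =
      fun y => ∃ q, I.lastStage ⟨Psi, arm, y⟩ t = q ∧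
        ((I.Exploits ⟨Psi, arm, y⟩ t q ∧ 0 = d.1 ∧
          I.pick t q ((I.arms ⟨Psi, arm, y⟩ t q).filter fun a =>
            ∀ a' ∈ I.arms ⟨Psi, arm, y⟩ t q,
              I.ucb ⟨Psi, arm, y⟩ t q a' ≤ I.ucb ⟨Psi, arm, y⟩ t q a) = d.2) ∨
        (¬ I.Exploits ⟨Psi, arm, y⟩ t q ∧ q = d.1 ∧
          I.pick t q ((I.arms ⟨Psi, arm, y⟩ t q).filter fun a =>
            1 / 2 ^ q < I.w ⟨Psi, arm, y⟩ t q a) = d.2)) := by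
    funext y
    refine propext ?_
    rw [exists_eq_left']
    simp only [Set.mem_singleton_iff, decision, Prod.ext_iff, stageLabel, chooseArm]
    by_cases hx : I.Exploits ⟨Psi, arm, y⟩ t (I.lastStage ⟨Psi, arm, y⟩ t)
    · simp only [hx, if_true, true_and, not_true_eq_false, false_and, or_false]
    · simp only [hx, if_false, false_and, not_false_eq_true, true_and, false_or]
  have harms : ∀ q a, Measurable fun y : ℕ → ℝ => a ∈ I.arms ⟨Psi, arm, y⟩ t q :=
    fun q a => I.measurable_mem_active Psi arm t (q - 1) a
  have hex := I.measurable_exploits Psi arm t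
  change Measurable fun y : ℕ → ℝ => I.decision ⟨Psi, arm, y⟩ t ∈ ({d} : Set (ℕ × Fin N))
  rw [h]
  refine Measurable.exists fun q =>
    (I.measurable_lastStage_eq Psi arm t hT q).and (Measurable.or ?_ ?_)
  · refine (hex q).and (measurable_const.and (measurable_pick_eq (fun a => ?_) (I.pick t q) d.2))
    simp only [Finset.mem_filter]
    refine (harms q a).and (Measurable.forall fun a' => (harms q a').imp ?_)
    exact measurableSet_setOfPred.1
      (measurableSet_le (I.measurable_ucb Psi arm t q a') (I.measurable_ucb Psi arm t q a))
  · refine (hex q).not.and (measurable_const.and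
      (measurable_pick_eq (fun a => ?_) (I.pick t q) d.2))
    simp only [Finset.mem_filter]
    exact (harms q a).and (measurableSet_setOfPred.1
      (measurableSet_lt measurable_const (I.measurable_w Psi arm t q a)))

end Measurability

end Input

namespace Input

variable {N : ℕ} {X : Type*} {I : Input N X}

/-! ### The regret of a single round. -/

section Round

lemma active_nonempty [NeZero N] (I : Input N X) (σ : State N) (t j : ℕ) :
    (I.active σ t j).Nonempty := by
  induction j with
  | zero => exact Finset.univ_nonempty
  | succ j ih =>
    obtain ⟨a, ha, hmax⟩ := Finset.exists_max_image _ (I.ucb σ t (j + 1)) ih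
    refine ⟨a, ?_⟩
    simp only [active, Finset.mem_filter]
    exact ⟨ha, fun a' ha' => (sub_le_self _ (by positivity)).trans (hmax a' ha')⟩

lemma chooseArm_of_exploits [NeZero N] (hpick : ∀ t q S, S.Nonempty → I.pick t q S ∈ S)
    {σ : State N} {t : ℕ} (h : I.Exploits σ t (I.lastStage σ t)) :
    I.chooseArm σ t ∈ I.arms σ t (I.lastStage σ t) ∧
      ∀ a ∈ I.arms σ t (I.lastStage σ t),
        I.ucb σ t (I.lastStage σ t) a ≤ I.ucb σ t (I.lastStage σ t) (I.chooseArm σ t) := by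
  classical
  obtain ⟨a, ha, hmax⟩ := Finset.exists_max_image _ (I.ucb σ t (I.lastStage σ t))
    (I.active_nonempty σ t (I.lastStage σ t - 1))
  have h1 := hpick t (I.lastStage σ t) ((I.arms σ t (I.lastStage σ t)).filter fun a =>
    ∀ a' ∈ I.arms σ t (I.lastStage σ t),
      I.ucb σ t (I.lastStage σ t) a' ≤ I.ucb σ t (I.lastStage σ t) a)
    ⟨a, Finset.mem_filter.2 ⟨ha, hmax⟩⟩
  have h2 : I.chooseArm σ t = I.pick t (I.lastStage σ t)
      ((I.arms σ t (I.lastStage σ t)).filter fun a => ∀ a' ∈ I.arms σ t (I.lastStage σ t),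
        I.ucb σ t (I.lastStage σ t) a' ≤ I.ucb σ t (I.lastStage σ t) a) := by
    simp only [chooseArm, h, if_true]
  rw [← h2] at h1
  exact Finset.mem_filter.1 h1

lemma chooseArm_of_not_exploits (hT : 1 ≤ I.T) (hpick : ∀ t q S, S.Nonempty → I.pick t q S ∈ S)
    {σ : State N} {t : ℕ} (h : ¬ I.Exploits σ t (I.lastStage σ t)) :
    I.chooseArm σ t ∈ I.arms σ t (I.lastStage σ t) ∧
      1 / 2 ^ (I.lastStage σ t) < I.w σ t (I.lastStage σ t) (I.chooseArm σ t) := by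
  classical
  have h0 := (I.lastStage_mem hT σ t).2.resolve_left h
  simp only [Narrow, not_forall, not_le] at h0
  obtain ⟨a, ha, hw⟩ := h0
  have h1 := hpick t (I.lastStage σ t) ((I.arms σ t (I.lastStage σ t)).filter fun a =>
    1 / 2 ^ (I.lastStage σ t) < I.w σ t (I.lastStage σ t) a) ⟨a, Finset.mem_filter.2 ⟨ha, hw⟩⟩
  have h2 : I.chooseArm σ t = I.pick t (I.lastStage σ t)
      ((I.arms σ t (I.lastStage σ t)).filter fun a =>
        1 / 2 ^ (I.lastStage σ t) < I.w σ t (I.lastStage σ t) a) := by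
    simp only [chooseArm, h, if_false]
  rw [← h2] at h1
  exact Finset.mem_filter.1 h1

/-- Passing stage j means that some width exceeds 1/√T while all are at most 2^{-j}; hence 2^j < √T.
-/
lemma lt_of_lt_lastStage (hT : 1 ≤ I.T) {Q : ℕ} (hQ : √(I.T : ℝ) ≤ 2 ^ Q) {σ : State N}
    {t j : ℕ} (h1 : 1 ≤ j) (hj : j < I.lastStage σ t) : j < Q := by
  obtain ⟨hE, hN⟩ := I.not_exploits_and_narrow_of_lt_lastStage h1 hj
  simp only [Exploits, not_forall, not_le] at hE
  obtain ⟨a, ha, hw⟩ := hE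
  have h2 := hw.trans_le (hN a ha)
  have hTpos : (0 : ℝ) < √(I.T : ℝ) := Real.sqrt_pos.2 (by exact_mod_cast hT)
  rw [one_div_lt_one_div hTpos (by positivity)] at h2
  exact (pow_lt_pow_iff_right₀ (one_lt_two (α := ℝ))).1 (h2.trans_le hQ)

lemma lastStage_le_of_sqrt_le (hT : 1 ≤ I.T) {Q : ℕ} (hQ1 : 1 ≤ Q) (hQ : √(I.T : ℝ) ≤ 2 ^ Q)
    (σ : State N) (t : ℕ) : I.lastStage σ t ≤ Q := by
  by_cases h : I.lastStage σ t ≤ 1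
  · exact h.trans hQ1
  · have := lt_of_lt_lastStage hT hQ (σ := σ) (t := t) (j := I.lastStage σ t - 1)
      (by omega) (by omega)
    omega

/-- The arms that survive, if the confidence bounds hold: the best arm is among them, and the
others are not much worse. -/
lemma active_spec (hT : 1 ≤ I.T) {Q : ℕ} (hQ : √(I.T : ℝ) ≤ 2 ^ Q) {σ : State N} {t : ℕ}
    {v : Fin N → ℝ} (hgood : ∀ a q, 1 ≤ q → q ≤ Q →
      |ridgeEstimate I.k I.lam (σ.Psi q) (I.played σ) σ.rew (I.ctx t a) - v a| ≤ I.w σ t q a)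
    {b : Fin N} (hb : ∀ a, v a ≤ v b) {j : ℕ} (hj : j < I.lastStage σ t) :
    b ∈ I.active σ t j ∧ (1 ≤ j → ∀ a ∈ I.active σ t j, v b - v a ≤ 8 / 2 ^ (j + 1)) := by
  have hucb : ∀ a q, 1 ≤ q → q ≤ Q →
      v a ≤ I.ucb σ t q a ∧ I.ucb σ t q a ≤ v a + 2 * I.w σ t q a := by
    intro a q h1 hq
    have := abs_le.1 (hgood a q h1 hq)
    unfold ucb
    constructor <;> linarith
  induction j with
  | zero => exact ⟨Finset.mem_univ _, fun h => absurd h (by omega)⟩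
  | succ j ih =>
    have ih' := ih (by omega)
    have hjQ : j + 1 ≤ Q := (lt_of_lt_lastStage hT hQ (by omega) hj).le
    have hN := (I.not_exploits_and_narrow_of_lt_lastStage (by omega) hj).2
    have hw : ∀ a ∈ I.active σ t j, I.w σ t (j + 1) a ≤ 1 / 2 ^ (j + 1) := hN
    have hp : (8 : ℝ) / 2 ^ (j + 1 + 1) = 4 / 2 ^ (j + 1) := by
      rw [pow_succ 2 (j + 1)]
      field_simp
      norm_num
    have h42 : (4 : ℝ) / 2 ^ (j + 1) = 2 / 2 ^ (j + 1) + 2 * (1 / 2 ^ (j + 1)) := by ring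
    constructor
    · simp only [active, Finset.mem_filter]
      -- The best arm survives: ucb_b ≥ v_b ≥ v_a ≥ ucb_a − 2w_a, and w_a ≤ 2^{-(j+1)}.
      refine ⟨ih'.1, fun a ha => ?_⟩
      have h1 := (hucb a (j + 1) (by omega) hjQ).2
      have h2 := (hucb b (j + 1) (by omega) hjQ).1
      have h3 := hw a ha
      have h4 := hb a
      have h5 : (2 : ℝ) / 2 ^ (j + 1) = 2 * (1 / 2 ^ (j + 1)) := by ring
      linarith
    -- Comparing with the surviving best arm: v_b ≤ ucb_b ≤ ucb_a + 2·2^{-(j+1)} ≤ v_a +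
    -- 4·2^{-(j+1)}, which is 8·2^{-q} for the next stage q = j + 2.
    · intro _ a ha
      simp only [active, Finset.mem_filter] at ha
      have h1 := (hucb a (j + 1) (by omega) hjQ).2
      have h2 := (hucb b (j + 1) (by omega) hjQ).1
      have h3 := hw a ha.1
      have h4 := ha.2 b ih'.1
      rw [hp, h42]
      linarith

/-- The regret of a single round, if the confidence bounds hold. -/
lemma round_regret_le [NeZero N] (hT : 1 ≤ I.T) (hpick : ∀ t q S, S.Nonempty → I.pick t q S ∈ S)
    {Q : ℕ} (hQ1 : 1 ≤ Q) (hQ : √(I.T : ℝ) ≤ 2 ^ Q) {σ : State N} {t : ℕ}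
    {v : Fin N → ℝ} (hgood : ∀ a q, 1 ≤ q → q ≤ Q →
      |ridgeEstimate I.k I.lam (σ.Psi q) (I.played σ) σ.rew (I.ctx t a) - v a| ≤ I.w σ t q a)
    {b : Fin N} (hb : ∀ a, v a ≤ v b) (hv : ∀ a, v a ∈ Set.Icc (0 : ℝ) 1) :
    (I.stageLabel σ t = 0 → v b - v (I.chooseArm σ t) ≤ 2 / √(I.T : ℝ)) ∧
    (I.stageLabel σ t ≠ 0 → I.stageLabel σ t ≤ Q ∧
      v b - v (I.chooseArm σ t) ≤ 8 * I.w σ t (I.stageLabel σ t) (I.chooseArm σ t)) := by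
  have hm := (I.lastStage_mem hT σ t).1
  have hle := lastStage_le_of_sqrt_le hT hQ1 hQ σ t
  have hact := active_spec hT hQ hgood hb (j := I.lastStage σ t - 1) (by omega)
  by_cases hE : I.Exploits σ t (I.lastStage σ t)
  · have hl : I.stageLabel σ t = 0 := by simp [stageLabel, hE]
    refine ⟨fun _ => ?_, fun h => absurd hl h⟩
    obtain ⟨hmem, hmax⟩ := chooseArm_of_exploits hpick hE
    have h1 := hmax b hact.1
    have h2 := hE _ hmem
    have h3 := abs_le.1 (hgood b _ hm hle)
    have h4 := abs_le.1 (hgood (I.chooseArm σ t) _ hm hle)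
    have h5 : 2 / √(I.T : ℝ) = 2 * (1 / √(I.T : ℝ)) := by ring
    unfold ucb at h1
    linarith
  · have hl : I.stageLabel σ t = I.lastStage σ t := by simp [stageLabel, hE]
    refine ⟨fun h => by omega, fun _ => ?_⟩
    rw [hl]
    refine ⟨hle, ?_⟩
    obtain ⟨hmem, hw⟩ := chooseArm_of_not_exploits hT hpick hE
    -- At stage 1 nothing has been eliminated, but the width exceeds 1/2 and the gap is at most 1.
    by_cases h1 : I.lastStage σ t = 1
    · have h2 := (hv b).2
      have h3 := (hv (I.chooseArm σ t)).1
      rw [h1] at hw ⊢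
      norm_num at hw
      linarith
    · have h2 := hact.2 (by omega) _ hmem
      rw [Nat.sub_add_cancel hm] at h2
      have h3 : (8 : ℝ) / 2 ^ I.lastStage σ t = 8 * (1 / 2 ^ I.lastStage σ t) := by ring
      linarith

end Round

/-! ### Summing the widths of all rounds. -/

section Total

variable [NeZero N] {H : Type*} [NormedAddCommGroup H] [InnerProductSpace ℝ H] {φ : X → H}

/-- The width of the chosen arm in round `t`, at the stage to which the round is added. -/
def playedWidth (I : Input N X) (r : ℕ → Fin N → ℝ) (t : ℕ) : ℝ :=
  stdWidth I.k I.lam ((I.run r t).Psi (I.hist r t).1) (fun τ => I.ctx τ (I.armAt r τ))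
    (I.ctx t (I.armAt r t))

lemma w_run_eq (hT : 1 ≤ I.T) (r : ℕ → Fin N → ℝ) (t : ℕ) (hl : (I.hist r t).1 ≠ 0) :
    I.w (I.run r t) t (I.hist r t).1 (I.armAt r t) =
      (I.alpha + I.c * √I.lam) * I.playedWidth r t := by
  rw [w, playedWidth]
  congr 1
  refine stdWidth_congr _ _ (fun τ hτ => ?_) _
  exact I.played_run hT r ((I.mem_run_Psi hT r (by omega)).1 hτ).1

/-- The rounds before `t` with label `q`. -/
def labelled (I : Input N X) (r : ℕ → Fin N → ℝ) (q t : ℕ) : Finset ℕ :=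
  (Finset.range t).filter fun τ => (I.hist r τ).1 = q

lemma labelled_eq_run_Psi (hT : 1 ≤ I.T) (r : ℕ → Fin N → ℝ) {q : ℕ} (hq : 1 ≤ q) (t : ℕ) :
    I.labelled r q t = (I.run r t).Psi q := by
  ext τ
  rw [I.mem_run_Psi hT r hq]
  simp [labelled]

/-- Telescoping: the index set grows only in rounds with label q, and the width of such a round is
computed from the set before insertion, so each round contributes exactly the factor of
`gainOn_insert`. -/
lemma sum_log_eq (hk : ∀ x y, I.k x y = inner ℝ (φ x) (φ y)) (hlam : 0 < I.lam) (hT : 1 ≤ I.T)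
    (r : ℕ → Fin N → ℝ) {q : ℕ} (hq : 1 ≤ q) (t : ℕ) :
    ∑ τ ∈ I.labelled r q t, Real.log (1 + I.playedWidth r τ ^ 2) =
      Real.log (gainOn I.k I.lam (I.labelled r q t) fun τ => I.ctx τ (I.armAt r τ)) := by
  induction t with
  | zero => simp [labelled, gainOn_empty]
  | succ t ih =>
    by_cases h : (I.hist r t).1 = q
    · have hi : I.labelled r q (t + 1) = insert t (I.labelled r q t) := by
        rw [labelled, Finset.range_add_one, Finset.filter_insert, if_pos h, labelled]
      have hn : t ∉ I.labelled r q t := by simp [labelled]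
      have hw : I.playedWidth r t = stdWidth I.k I.lam (I.labelled r q t)
          (fun τ => I.ctx τ (I.armAt r τ)) (I.ctx t (I.armAt r t)) := by
        rw [playedWidth, h, labelled_eq_run_Psi hT r hq]
      rw [hi, Finset.sum_insert hn, ih, gainOn_insert hk hlam _ hn,
        Real.log_mul (gainOn_pos hk hlam _ _).ne' (by positivity), ← hw, add_comm]
    · have hi : I.labelled r q (t + 1) = I.labelled r q t := by
        rw [labelled, Finset.range_add_one, Finset.filter_insert, if_neg h, labelled]
      rw [hi, ih]

/-- The points whose kernel matrix enters `g([T])`. -/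
def allPoints (I : Input N X) (r : ℕ → Fin N → ℝ) (x : X) (τ : ℕ) : X :=
  if τ < I.T then I.ctx τ (I.armAt r τ) else x

lemma g_eq_gainOn (r : ℕ → Fin N → ℝ) (x : X) :
    I.g r x = gainOn I.k I.lam (Finset.range (I.T + 1)) (I.allPoints r x) := by
  rw [← gainDet_eq_gainOn, g]
  congr 1

lemma one_le_g (hk : ∀ x y, I.k x y = inner ℝ (φ x) (φ y)) (hlam : 0 < I.lam)
    (r : ℕ → Fin N → ℝ) (x : X) : 1 ≤ I.g r x := by
  rw [g_eq_gainOn, ← gainOn_empty (k := I.k) (lam := I.lam) (I.allPoints r x)]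
  exact gainOn_mono hk hlam (Finset.empty_subset _) _

lemma sum_log_le_log_g (hk : ∀ x y, I.k x y = inner ℝ (φ x) (φ y)) (hlam : 0 < I.lam)
    (hT : 1 ≤ I.T) (r : ℕ → Fin N → ℝ) {q : ℕ} (hq : 1 ≤ q) (x : X) :
    ∑ τ ∈ I.labelled r q I.T, Real.log (1 + I.playedWidth r τ ^ 2) ≤ Real.log (I.g r x) := by
  have hsub : I.labelled r q I.T ⊆ Finset.range I.T := Finset.filter_subset _ _
  rw [sum_log_eq hk hlam hT r hq, g_eq_gainOn,
    gainOn_congr I.k I.lam (p' := I.allPoints r x) fun τ hτ => by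
      simp [allPoints, Finset.mem_range.1 (hsub hτ)]]
  refine Real.log_le_log (gainOn_pos hk hlam _ _) (gainOn_mono hk hlam (hsub.trans ?_) _)
  exact Finset.range_mono (Nat.le_succ _)

/-- The chord of the logarithm over [1, 2] gives log(1 + y) ≥ y log 2 for y = x/m ≤ 1; then use y ≤
x and log 2 ≥ 2/3. -/
lemma le_mul_log_one_add {m x : ℝ} (hm : 1 ≤ m) (hx : 0 ≤ x) (hxm : x ≤ m) :
    x ≤ 3 / 2 * m * Real.log (1 + x) := by
  have hlog2 : (2 : ℝ) / 3 ≤ Real.log 2 := by linarith [Real.log_two_gt_d9]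
  have hm0 : 0 < m := by linarith
  have hy : x / m ≤ 1 := (div_le_one hm0).2 hxm
  have hy0 : 0 ≤ x / m := by positivity
  -- concavity of the logarithm on `[1, 2]`
  have hc := strictConcaveOn_log_Ioi.concaveOn.2 (show (1 : ℝ) ∈ Set.Ioi 0 by simp)
    (show (2 : ℝ) ∈ Set.Ioi 0 by simp) (sub_nonneg.2 hy) hy0 (by ring)
  simp only [smul_eq_mul, Real.log_one, mul_zero, zero_add] at hc
  have h1 : Real.log ((1 - x / m) * 1 + x / m * 2) ≤ Real.log (1 + x) := by
    refine Real.log_le_log (by nlinarith) ?_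
    have : x / m ≤ x := div_le_self hx hm
    linarith
  have h2 : x / m * (2 / 3) ≤ Real.log (1 + x) :=
    (mul_le_mul_of_nonneg_left hlog2 hy0).trans (hc.trans h1)
  have h3 : x = 3 / 2 * m * (x / m * (2 / 3)) := by field_simp
  calc x = 3 / 2 * m * (x / m * (2 / 3)) := h3
    _ ≤ _ := by gcongr

/-- The sum of the squared widths over the rounds of one stage. -/
lemma sum_playedWidth_sq_le (hk : ∀ x y, I.k x y = inner ℝ (φ x) (φ y)) (hlam : 0 < I.lam)
    (hT : 1 ≤ I.T) (r : ℕ → Fin N → ℝ) {ck : ℝ} (hck : ∀ x, I.k x x ≤ ck) {q : ℕ} (hq : 1 ≤ q)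
    (x : X) :
    ∑ τ ∈ I.labelled r q I.T, I.playedWidth r τ ^ 2 ≤
      3 / 2 * max 1 (ck / I.lam) * Real.log (I.g r x) := by
  calc ∑ τ ∈ I.labelled r q I.T, I.playedWidth r τ ^ 2
      ≤ ∑ τ ∈ I.labelled r q I.T,
          3 / 2 * max 1 (ck / I.lam) * Real.log (1 + I.playedWidth r τ ^ 2) := by
        refine Finset.sum_le_sum fun τ _ => ?_
        refine le_mul_log_one_add (le_max_left _ _) (sq_nonneg _) (le_max_of_le_right ?_)
        exact (stdWidth_sq_le hk hlam _ _ _).trans (by gcongr; exact hck _)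
    _ ≤ _ := by
        rw [← Finset.mul_sum]
        have := sum_log_le_log_g hk hlam hT r hq x
        gcongr

/-- The regret in terms of expected rewards, if the confidence bounds hold. -/
lemma regret_le_of_good (hk : ∀ x y, I.k x y = inner ℝ (φ x) (φ y)) (hlam : 0 < I.lam)
    (hT : 1 ≤ I.T) (hpick : ∀ t q S, S.Nonempty → I.pick t q S ∈ S)
    {ck : ℝ} (hck : ∀ x, I.k x x ≤ ck) (hW : 0 ≤ I.alpha + I.c * √I.lam)
    {Q : ℕ} (hQ1 : 1 ≤ Q) (hQ : √(I.T : ℝ) ≤ 2 ^ Q) (r v : ℕ → Fin N → ℝ)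
    (hgood : ∀ t < I.T, ∀ a q, 1 ≤ q → q ≤ Q →
      |ridgeEstimate I.k I.lam ((I.run r t).Psi q) (I.played (I.run r t)) (I.run r t).rew
        (I.ctx t a) - v t a| ≤ I.w (I.run r t) t q a)
    {best : ℕ → Fin N} (hbest : ∀ t < I.T, ∀ a, v t a ≤ v t (best t))
    (hv : ∀ t < I.T, ∀ a, v t a ∈ Set.Icc (0 : ℝ) 1) (x : X) :
    I.regret r v best ≤ 2 * √(I.T : ℝ) +
      7 * (I.alpha + I.c * √I.lam) * √(2 * max 1 (ck / I.lam) * Real.log (I.g r x)) *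
        √(I.T * Q) := by
  set m := max 1 (ck / I.lam) with hm
  set L := Real.log (I.g r x) with hL
  set W := I.alpha + I.c * √I.lam with hWdef
  have hL0 : 0 ≤ L := Real.log_nonneg (one_le_g hk hlam r x)
  have hm1 : 1 ≤ m := le_max_left _ _
  have hT0 : (0 : ℝ) < I.T := by exact_mod_cast hT
  have hround : ∀ t ∈ Finset.range I.T, v t (best t) - v t (I.armAt r t) ≤
      2 / √(I.T : ℝ) + if (I.hist r t).1 = 0 then 0 else 8 * W * I.playedWidth r t := by
    intro t ht
    have ht' := Finset.mem_range.1 ht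
    have h := round_regret_le hT hpick hQ1 hQ (hgood t ht') (hbest t ht') (hv t ht')
    split_ifs with hl
    · rw [add_zero]
      exact h.1 hl
    · have h2 := (h.2 hl).2
      have h3 := w_run_eq hT r t hl
      have h4 : (0 : ℝ) ≤ 2 / √(I.T : ℝ) := by positivity
      change _ ≤ 8 * I.w (I.run r t) t (I.hist r t).1 (I.armAt r t) at h2
      rw [h3] at h2
      change v t (best t) - v t (I.armAt r t) ≤ _ at h2
      linarith
  set F := (Finset.range I.T).filter fun t => ¬ (I.hist r t).1 = 0 with hF
  -- Split by label: each of the at most `Q` stages has the same budget.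
  have hsq : ∑ t ∈ F, I.playedWidth r t ^ 2 ≤ Q * (3 / 2 * m * L) := by
    have hmaps : ∀ t ∈ F, (I.hist r t).1 ∈ Finset.Icc 1 Q := by
      intro t ht
      obtain ⟨ht1, hl⟩ := Finset.mem_filter.1 ht
      have ht' := Finset.mem_range.1 ht1
      have h := round_regret_le hT hpick hQ1 hQ (hgood t ht') (hbest t ht') (hv t ht')
      exact Finset.mem_Icc.2 ⟨Nat.one_le_iff_ne_zero.2 hl, (h.2 hl).1⟩
    rw [← Finset.sum_fiberwise_of_maps_to hmaps]
    calc _ ≤ ∑ q ∈ Finset.Icc 1 Q, 3 / 2 * m * L := by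
          refine Finset.sum_le_sum fun q hq => ?_
          have hq1 := (Finset.mem_Icc.1 hq).1
          have he : F.filter (fun t => (I.hist r t).1 = q) = I.labelled r q I.T := by
            ext t
            simp only [hF, labelled, Finset.mem_filter]
            constructor
            · tauto
            · rintro ⟨h1, h2⟩
              exact ⟨⟨h1, by omega⟩, h2⟩
          rw [he]
          exact sum_playedWidth_sq_le hk hlam hT r hck hq1 x
      _ = _ := by simp
  -- Cauchy–Schwarz over at most T rounds.
  have hsum : ∑ t ∈ F, I.playedWidth r t ≤ √(I.T * (Q * (3 / 2 * m * L))) := by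
    refine Real.le_sqrt_of_sq_le ?_
    refine sq_sum_le_card_mul_sum_sq.trans ?_
    have hcard : (F.card : ℝ) ≤ I.T := by
      exact_mod_cast (Finset.card_filter_le _ _).trans (Finset.card_range _).le
    have hnn : 0 ≤ ∑ t ∈ F, I.playedWidth r t ^ 2 := Finset.sum_nonneg fun _ _ => sq_nonneg _
    exact mul_le_mul hcard hsq hnn hT0.le
  -- The constant 7 comes from 8√(3/4) < 7.
  have hroot : 8 * √(I.T * (Q * (3 / 2 * m * L))) ≤ 7 * (√(2 * m * L) * √(I.T * Q)) := by
    rw [← Real.sqrt_mul (by positivity)]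
    have h1 : (I.T * (Q * (3 / 2 * m * L)) : ℝ) = 3 / 4 * (2 * m * L * (I.T * Q)) := by ring
    rw [h1, Real.sqrt_mul (by norm_num), ← mul_assoc]
    refine mul_le_mul_of_nonneg_right ?_ (Real.sqrt_nonneg _)
    have h2 : √(3 / 4 : ℝ) ≤ 7 / 8 := by
      rw [Real.sqrt_le_left (by norm_num)]
      norm_num
    linarith
  have hfirst : (I.T : ℝ) * (2 / √(I.T : ℝ)) = 2 * √(I.T : ℝ) := by
    have h3 : (I.T : ℝ) = √(I.T : ℝ) * √(I.T : ℝ) := (Real.mul_self_sqrt hT0.le).symm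
    have h4 : √(I.T : ℝ) ≠ 0 := (Real.sqrt_pos.2 hT0).ne'
    field_simp
    rw [Real.sq_sqrt hT0.le]
  calc I.regret r v best
      = ∑ t ∈ Finset.range I.T, (v t (best t) - v t (I.armAt r t)) := by
        rw [regret, Finset.sum_sub_distrib]
    _ ≤ ∑ t ∈ Finset.range I.T,
          (2 / √(I.T : ℝ) + if (I.hist r t).1 = 0 then 0 else 8 * W * I.playedWidth r t) :=
        Finset.sum_le_sum hround
    _ = 2 * √(I.T : ℝ) + 8 * W * ∑ t ∈ F, I.playedWidth r t := by
        rw [Finset.sum_add_distrib, Finset.sum_const, Finset.card_range, nsmul_eq_mul, hfirst,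
          hF, Finset.sum_filter, Finset.mul_sum]
        congr 1
        refine Finset.sum_congr rfl fun t _ => ?_
        split_ifs <;> simp_all
    _ ≤ 2 * √(I.T : ℝ) + 8 * W * √(I.T * (Q * (3 / 2 * m * L))) := by gcongr
    _ ≤ _ := by
        have := mul_le_mul_of_nonneg_left hroot hW
        linarith

end Total

end Input

/-! ### Sub-Gaussian sums with increments selected by the past. -/

section SubGaussian

variable {Ω : Type*} {mΩ : MeasurableSpace Ω} {P : Measure Ω}

lemma indepFun_of_indep {β γ : Type*} [MeasurableSpace β] [MeasurableSpace γ]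
    {m₁ m₂ : MeasurableSpace Ω} (h : Indep m₁ m₂ P) {f : Ω → β} {g : Ω → γ}
    (hf : Measurable[m₁] f) (hg : Measurable[m₂] g) : IndepFun f g P := by
  rw [IndepFun_iff_Indep]
  exact indep_of_indep_of_le_left (indep_of_indep_of_le_right h hg.comap_le) hf.comap_le

/-- Adding a fresh increment that is selected by looking at the past. -/
lemma hasSubgaussianMGF_add_selected {ι : Type*} [Fintype ι] [MeasurableSpace ι]
    [MeasurableSingletonClass ι] {m₁ m₂ : MeasurableSpace Ω} (h₁ : m₁ ≤ mΩ)
    (hind : Indep m₁ m₂ P) {Y : Ω → ℝ} {A : Ω → ι} {D : ι → Ω → ℝ} {cY cD : NNReal}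
    (hYm : Measurable[m₁] Y) (hAm : Measurable[m₁] A) (hDm : ∀ a, Measurable[m₂] (D a))
    (hY : HasSubgaussianMGF Y cY P) (hD : ∀ a, HasSubgaussianMGF (D a) cD P) :
    HasSubgaussianMGF (fun ω => Y ω + D (A ω) ω) (cY + cD) P := by
  classical
  -- Cut exp(sY) along the level sets of `A`. On {A = a} the increment is `D a`, which is
  -- independent of the piece `U s a`, so each expectation factors; the pieces add up to exp(sY)
  -- again.
  let U : ℝ → ι → Ω → ℝ := fun s a => (A ⁻¹' {a}).indicator fun ω => Real.exp (s * Y ω)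
  have hUm : ∀ s a, Measurable[m₁] (U s a) := fun s a =>
    Measurable.indicator (Real.measurable_exp.comp (hYm.const_mul s))
      (hAm (measurableSet_singleton a))
  have hVm : ∀ s a, Measurable[m₂] fun ω => Real.exp (s * D a ω) := fun s a =>
    Real.measurable_exp.comp ((hDm a).const_mul s)
  have hU : ∀ s a, Integrable (U s a) P := fun s a =>
    (hY.integrable_exp_mul s).indicator (h₁ _ (hAm (measurableSet_singleton a)))
  have hUV : ∀ s a, IndepFun (U s a) (fun ω => Real.exp (s * D a ω)) P := fun s a =>
    indepFun_of_indep hind (hUm s a) (hVm s a)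
  have hUVint : ∀ s a, Integrable (fun ω => U s a ω * Real.exp (s * D a ω)) P := fun s a =>
    (hUV s a).integrable_mul (hU s a) ((hD a).integrable_exp_mul s)
  have hUsum : ∀ s ω, ∑ a, U s a ω = Real.exp (s * Y ω) := by
    intro s ω
    rw [Finset.sum_eq_single (A ω)]
    · simp [U]
    · intro a _ ha
      simp [U, ha.symm]
    · simp
  have hsplit : ∀ s ω, Real.exp (s * (Y ω + D (A ω) ω)) =
      ∑ a, U s a ω * Real.exp (s * D a ω) := by
    intro s ω
    rw [Finset.sum_eq_single (A ω)]
    · simp [U, mul_add, Real.exp_add]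
    · intro a _ ha
      simp [U, ha.symm]
    · simp
  refine ⟨fun s => ?_, fun s => ?_⟩
  · simp only [hsplit]
    exact integrable_finsetSum _ fun a _ => hUVint s a
  · simp only [mgf, hsplit]
    rw [integral_finsetSum _ fun a _ => hUVint s a]
    calc ∑ a, ∫ ω, U s a ω * Real.exp (s * D a ω) ∂P
        = ∑ a, (∫ ω, U s a ω ∂P) * ∫ ω, Real.exp (s * D a ω) ∂P := by
          refine Finset.sum_congr rfl fun a _ => ?_
          exact (hUV s a).integral_fun_mul_eq_mul_integral (hU s a).aestronglyMeasurable
            ((hD a).integrable_exp_mul s).aestronglyMeasurable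
      _ ≤ ∑ a, (∫ ω, U s a ω ∂P) * Real.exp (cD * s ^ 2 / 2) := by
          refine Finset.sum_le_sum fun a _ => mul_le_mul_of_nonneg_left ((hD a).mgf_le s) ?_
          exact integral_nonneg fun ω => Set.indicator_nonneg (fun _ _ => (Real.exp_pos _).le) _
      _ = mgf Y P s * Real.exp (cD * s ^ 2 / 2) := by
          rw [← Finset.sum_mul, ← integral_finsetSum _ fun a _ => hU s a]
          simp only [hUsum, mgf]
      _ ≤ Real.exp (cY * s ^ 2 / 2) * Real.exp (cD * s ^ 2 / 2) :=
          mul_le_mul_of_nonneg_right (hY.mgf_le s) (Real.exp_pos _).le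
      _ = _ := by
          rw [← Real.exp_add]
          congr 1
          push_cast
          ring

variable [IsProbabilityMeasure P]

/-- A form of the Azuma–Hoeffding inequality: sums of increments, each selected by looking at the
past from a finite family that is independent of the past. -/
lemma hasSubgaussianMGF_sum_selected {ι : Type*} [Fintype ι] [MeasurableSpace ι]
    [MeasurableSingletonClass ι] {past fresh : ℕ → MeasurableSpace Ω} {n : ℕ}
    (hpast : ∀ t, past t ≤ mΩ) (hmono : ∀ t, past t ≤ past (t + 1))
    (hfresh : ∀ t, fresh t ≤ past (t + 1)) (hind : ∀ t < n, Indep (past t) (fresh t) P)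
    {A : ℕ → Ω → ι} {D : ℕ → ι → Ω → ℝ} (hA : ∀ t < n, Measurable[past t] (A t))
    (hDm : ∀ t < n, ∀ a, Measurable[fresh t] (D t a))
    (hD : ∀ t < n, ∀ a, HasSubgaussianMGF (D t a) 1 P) :
    HasSubgaussianMGF (fun ω => ∑ t ∈ Finset.range n, D t (A t ω) ω) n P := by
  classical
  -- Measurability of the partial sum with respect to the past is carried along, since the next
  -- increment must be independent of it.
  suffices h : ∀ j ≤ n, Measurable[past j] (fun ω => ∑ t ∈ Finset.range j, D t (A t ω) ω) ∧
      HasSubgaussianMGF (fun ω => ∑ t ∈ Finset.range j, D t (A t ω) ω) j P from (h n le_rfl).2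
  intro j
  induction j with
  | zero => simp
  | succ j ih =>
    intro hj
    obtain ⟨h1, h2⟩ := ih (by omega)
    have hjn : j < n := by omega
    simp only [Finset.sum_range_succ]
    constructor
    · refine Measurable.add (h1.mono (hmono j) le_rfl) ?_
      have he : (fun ω => D j (A j ω) ω) =
          fun ω => ∑ a, (A j ⁻¹' {a}).indicator (D j a) ω := by
        funext ω
        rw [Finset.sum_eq_single (A j ω)]
        · simp
        · intro a _ ha
          simp [Set.indicator, ha.symm]
        · simp
      rw [he]
      refine Finset.measurable_sum _ fun a _ => Measurable.indicator ?_ ?_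
      · exact (hDm j hjn a).mono (hfresh j) le_rfl
      · exact hmono j _ (hA j hjn (measurableSet_singleton a))
    · push_cast
      exact hasSubgaussianMGF_add_selected (hpast j) (hind j hjn) h1
        (hA j hjn) (hDm j hjn) h2 (hD j hjn)

/-- Only the fibres have to be measurable; for `B` subadditivity is enough, so bad events need no
measurability proof. -/
lemma measure_le_of_fibers {β : Type*} [Countable β] {K : Ω → β}
    (hK : ∀ b, MeasurableSet (K ⁻¹' {b})) {B : Set Ω} {p : ENNReal}
    (h : ∀ b, P (B ∩ K ⁻¹' {b}) ≤ p * P (K ⁻¹' {b})) : P B ≤ p := by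
  calc P B ≤ P (⋃ b, B ∩ K ⁻¹' {b}) := by
        refine measure_mono fun ω hω => ?_
        simp [hω]
    _ ≤ ∑' b, P (B ∩ K ⁻¹' {b}) := measure_iUnion_le _
    _ ≤ ∑' b, p * P (K ⁻¹' {b}) := ENNReal.tsum_le_tsum h
    _ = p * P (⋃ b, K ⁻¹' {b}) := by
        rw [ENNReal.tsum_mul_left, measure_iUnion _ hK]
        intro a b hab
        exact (Set.disjoint_singleton.2 hab).preimage K
    _ ≤ p := by
        simpa using mul_le_mul_right (prob_le_one (μ := P) (s := ⋃ b, K ⁻¹' {b})) p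

end SubGaussian

lemma measurableSet_lt_abs_weightedSum {Ω : Type*} {m : MeasurableSpace Ω} {S : Finset ℕ}
    (b d : S → ℝ) (c : ℝ) {f : S → Ω → ℝ} (hf : ∀ i, Measurable (f i)) :
    MeasurableSet {ω | c < |∑ i, b i * (f i ω - d i)|} :=
  measurableSet_lt measurable_const
    (Finset.measurable_sum _ fun i _ => ((hf i).sub_const _).const_mul _).abs

/-! ### Independence and Hoeffding's inequality for rewards. -/

section Rewards

variable {N : ℕ} {Ω : Type*} {mΩ : MeasurableSpace Ω} {P : Measure Ω}
  {T : ℕ} {r : ℕ → Fin N → Ω → ℝ}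

/-- The σ-algebra generated by the reward vectors of the rounds `t < T` in `U`. -/
def rewardSigma (T : ℕ) (r : ℕ → Fin N → Ω → ℝ) (U : Set ℕ) : MeasurableSpace Ω :=
  ⨆ i ∈ {i : Fin T | (i : ℕ) ∈ U},
    MeasurableSpace.comap (fun ω a => r i a ω) (inferInstance : MeasurableSpace (Fin N → ℝ))

lemma measurable_reward {U : Set ℕ} {t : ℕ} (ht : t < T) (hU : t ∈ U) (a : Fin N) :
    Measurable[rewardSigma T r U] (r t a) := by
  have h1 : MeasurableSpace.comap (fun ω a => r t a ω)
      (inferInstance : MeasurableSpace (Fin N → ℝ)) ≤ rewardSigma T r U :=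
    le_iSup₂_of_le (f := fun (i : Fin T) (_ : i ∈ {i : Fin T | (i : ℕ) ∈ U}) =>
      MeasurableSpace.comap (fun ω a => r i a ω) (inferInstance : MeasurableSpace (Fin N → ℝ)))
      ⟨t, ht⟩ hU le_rfl
  have h2 : Measurable[MeasurableSpace.comap (fun ω a => r t a ω)
      (inferInstance : MeasurableSpace (Fin N → ℝ))] (fun ω a => r t a ω) :=
    comap_measurable _
  exact ((measurable_pi_apply a).comp h2).mono h1 le_rfl

lemma comap_reward_le (hmeas : ∀ t < T, ∀ a, Measurable (r t a)) (i : Fin T) :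
    MeasurableSpace.comap (fun ω a => r i a ω) (inferInstance : MeasurableSpace (Fin N → ℝ)) ≤
      mΩ :=
  (measurable_pi_lambda _ fun a => hmeas i i.2 a).comap_le

lemma rewardSigma_le (hmeas : ∀ t < T, ∀ a, Measurable (r t a)) (U : Set ℕ) :
    rewardSigma T r U ≤ mΩ :=
  iSup₂_le fun i _ => comap_reward_le hmeas i

lemma rewardSigma_mono {U U' : Set ℕ} (h : U ⊆ U') : rewardSigma T r U ≤ rewardSigma T r U' :=
  biSup_mono fun _ hi => h hi

lemma indep_rewardSigma (hmeas : ∀ t < T, ∀ a, Measurable (r t a))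
    (hind : iIndepFun (fun (t : Fin T) ω a => r t a ω) P) {U U' : Set ℕ} (h : Disjoint U U') :
    Indep (rewardSigma T r U) (rewardSigma T r U') P :=
  indep_iSup_of_disjoint (comap_reward_le hmeas) hind.iIndep
    (Set.disjoint_left.2 fun _ hi hi' => Set.disjoint_left.1 h hi hi')

variable [IsProbabilityMeasure P]

/-- Hoeffding's inequality for weighted sums of rewards of fixed arms. -/
lemma measure_noise_le (hmeas : ∀ t < T, ∀ a, Measurable (r t a))
    (hbdd : ∀ t < T, ∀ a, ∀ᵐ ω ∂P, r t a ω ∈ Set.Icc (0 : ℝ) 1)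
    (hind : iIndepFun (fun (t : Fin T) ω a => r t a ω) P) {S : Finset ℕ} (hS : ∀ τ ∈ S, τ < T)
    (arm : ℕ → Fin N) (b : S → ℝ) {s α : ℝ} (hα : 0 ≤ α) (hs : 0 ≤ s)
    (hb : ∑ i, b i ^ 2 ≤ s ^ 2) :
    P {ω | α * s < |∑ i : S, b i * (r i (arm i) ω - ∫ ω', r i (arm i) ω' ∂P)|} ≤
      ENNReal.ofReal (2 * Real.exp (-(2 * α ^ 2))) := by
  set Z : Ω → ℝ := fun ω => ∑ i : S, b i * (r i (arm i) ω - ∫ ω', r i (arm i) ω' ∂P) with hZ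
  have hind' : iIndepFun
      (fun (i : S) ω => b i * (r i (arm i) ω - ∫ ω', r i (arm i) ω' ∂P)) P := by
    have h1 := hind.precomp (g := fun i : S => (⟨i, hS i i.2⟩ : Fin T))
      (fun i j hij => Subtype.ext (by simpa using hij))
    exact h1.comp (fun (i : S) (y : Fin N → ℝ) => b i * (y (arm i) - ∫ ω', r i (arm i) ω' ∂P))
      (fun i => by fun_prop)
  -- A variable in [0, 1] has variance proxy 1/4, scaled by the squared weight.
  let cc : S → NNReal := fun i => ⟨b i ^ 2, sq_nonneg _⟩ * ((‖(1 : ℝ) - 0‖₊ / 2) ^ 2)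
  have hsub : HasSubgaussianMGF Z (∑ i, cc i) P :=
    HasSubgaussianMGF.sum_of_iIndepFun hind' fun i _ =>
      (hasSubgaussianMGF_of_mem_Icc (hmeas i (hS i i.2) _).aemeasurable
        (hbdd i (hS i i.2) (arm i))).const_mul (b i)
  have hcc : ((∑ i, cc i : NNReal) : ℝ) = (∑ i, b i ^ 2) / 4 := by
    push_cast
    rw [Finset.sum_div]
    refine Finset.sum_congr rfl fun i _ => ?_
    change b i ^ 2 * (((‖(1 : ℝ) - 0‖₊ / 2) ^ 2 : NNReal) : ℝ) = _
    norm_num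
    ring
  -- With all weights zero the Hoeffding exponent would divide by zero; the event is then empty.
  by_cases h0 : ∑ i, b i ^ 2 = 0
  · have hbz : ∀ i, b i = 0 := fun i => by
      have := (Finset.sum_eq_zero_iff_of_nonneg (fun i _ => sq_nonneg (b i))).1 h0 i
        (Finset.mem_univ _)
      exact pow_eq_zero_iff (two_ne_zero) |>.1 this
    have he : {ω | α * s < |Z ω|} = ∅ := by
      ext ω
      have : 0 ≤ α * s := by positivity
      simp [hZ, hbz, this]
    rw [he]
    simp
  have hpos : 0 < ∑ i, b i ^ 2 :=
    lt_of_le_of_ne (Finset.sum_nonneg fun i _ => sq_nonneg _) (Ne.symm h0)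
  have hexp : Real.exp (-(α * s) ^ 2 / (2 * ((∑ i, cc i : NNReal) : ℝ))) ≤
      Real.exp (-(2 * α ^ 2)) := by
    rw [Real.exp_le_exp, hcc, neg_div, neg_le_neg_iff, le_div_iff₀ (by positivity)]
    have := mul_le_mul_of_nonneg_left hb (sq_nonneg α)
    nlinarith
  have hαs : 0 ≤ α * s := by positivity
  have t1 := (hsub.measure_ge_le hαs).trans hexp
  have t2 := (hsub.neg.measure_ge_le hαs).trans hexp
  have hsubset : {ω | α * s < |Z ω|} ⊆ {ω | α * s ≤ Z ω} ∪ {ω | α * s ≤ (-Z) ω} := by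
    intro ω hω
    have hω' : α * s < |Z ω| := hω
    rcases lt_abs.1 hω' with h | h
    · exact Or.inl h.le
    · exact Or.inr h.le
  have t3 : P.real {ω | α * s < |Z ω|} ≤ 2 * Real.exp (-(2 * α ^ 2)) :=
    (measureReal_mono hsubset).trans ((measureReal_union_le _ _).trans (by linarith))
  rw [← ofReal_measureReal]
  exact ENNReal.ofReal_le_ofReal t3

end Rewards

/-! ### Probability bounds for the run. -/

namespace Input

variable {N : ℕ} [NeZero N] {X Ω : Type*} {mΩ : MeasurableSpace Ω} {P : Measure Ω}
  {I : Input N X} {r : ℕ → Fin N → Ω → ℝ}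

lemma measurable_decision_ofHist (hT : 1 ≤ I.T) {U : Set ℕ} (κ : ℕ → ℕ × Fin N) {t : ℕ}
    {y : ℕ → Fin N → Ω → ℝ} (hy : ∀ τ < t, ∀ a, Measurable[rewardSigma I.T r U] (y τ a)) :
    Measurable[rewardSigma I.T r U]
      fun ω => I.decision (ofHist κ (fun τ a => y τ a ω) t) t := by
  have h1 : Measurable[rewardSigma I.T r U]
      fun ω τ => if τ < t then y τ (κ τ).2 ω else 0 := by
    refine @measurable_pi_lambda _ _ _ (rewardSigma I.T r U) _ _ fun τ => ?_
    by_cases hτ : τ < t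
    · simpa [hτ] using hy τ hτ _
    · simp only [hτ, if_false]
      exact @measurable_const _ _ _ (_) _
  exact (I.measurable_decision (fun q => (Finset.range t).filter fun τ => (κ τ).1 = q ∧ q ≠ 0)
    (fun τ => if τ < t then (κ τ).2 else 0) t hT).comp h1

/-- The history up to stage `q` depends on the rewards of the stages below `q` only. -/
lemma measurableSet_truncate_hist (hT : 1 ≤ I.T) (κ : ℕ → ℕ × Fin N) (q : ℕ) {t : ℕ}
    (ht : t ≤ I.T) :
    MeasurableSet[rewardSigma I.T r {τ | 1 ≤ (κ τ).1 ∧ (κ τ).1 < q}]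
      {ω | ∀ τ < t, truncate q (I.hist (fun t a => r t a ω) τ) = κ τ} := by
  induction t with
  | zero => simp
  | succ t ih =>
    -- Given the earlier truncated outcomes, the next one is a function of κ and of the rewards at
    -- labels below q; all other entries are blanked.
    have he : {ω | ∀ τ < t + 1, truncate q (I.hist (fun t a => r t a ω) τ) = κ τ} =
        {ω | ∀ τ < t, truncate q (I.hist (fun t a => r t a ω) τ) = κ τ} ∩
        (fun ω => I.decision (ofHist κ
          (fun τ a => if 1 ≤ (κ τ).1 ∧ (κ τ).1 < q then r τ a ω else 0) t) t) ⁻¹'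
          {d | truncate q d = κ t} := by
      ext ω
      simp only [Set.mem_ofPred_eq, Set.mem_inter_iff, Set.mem_preimage, Nat.forall_lt_succ_right]
      refine and_congr_right fun h => ?_
      rw [truncate_hist hT _ h]
      rfl
    rw [he]
    refine MeasurableSet.inter (ih (by omega)) ?_
    have hm := measurable_decision_ofHist (I := I) (r := r) hT (t := t)
      (U := {τ | 1 ≤ (κ τ).1 ∧ (κ τ).1 < q}) κ
      (y := fun τ a ω => if 1 ≤ (κ τ).1 ∧ (κ τ).1 < q then r τ a ω else 0) (by
        intro τ hτ a
        by_cases h : 1 ≤ (κ τ).1 ∧ (κ τ).1 < q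
        · simp only [h, and_self, if_true]
          exact measurable_reward (by omega) h a
        · simp only [h, if_false]
          exact @measurable_const _ _ _ (_) _)
    exact hm (MeasurableSet.of_discrete)

lemma ofHist_congr {κ κ' : ℕ → ℕ × Fin N} (y : ℕ → Fin N → ℝ) {t : ℕ}
    (h : ∀ τ < t, κ τ = κ' τ) : ofHist κ y t = ofHist κ' y t := by
  simp only [ofHist, State.mk.injEq]
  refine ⟨?_, ?_, ?_⟩
  · funext q
    refine Finset.filter_congr fun τ hτ => ?_
    rw [h τ (Finset.mem_range.1 hτ)]
  · funext τ
    split_ifs with hτ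
    · rw [h τ hτ]
    · rfl
  · funext τ
    split_ifs with hτ
    · rw [h τ hτ]
    · rfl

/-- The extension of a finite history by `(0, 0)`. -/
def extendHist {t : ℕ} (κ : Fin t → ℕ × Fin N) (τ : ℕ) : ℕ × Fin N :=
  -- Label 0 keeps the rounds from `t` on out of every index set.
  if h : τ < t then κ ⟨τ, h⟩ else (0, 0)

lemma forall_lt_eq_extendHist_iff {t : ℕ} (κ : Fin t → ℕ × Fin N) (h : ℕ → ℕ × Fin N) :
    (∀ τ < t, h τ = extendHist κ τ) ↔ (fun i : Fin t => h i) = κ := by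
  constructor
  · intro H
    funext i
    rw [H i i.2]
    simp [extendHist]
  · rintro rfl τ hτ
    simp [extendHist, hτ]

/-- The outcome of a round depends on the rewards of the earlier rounds only. -/
lemma measurable_hist (hT : 1 ≤ I.T) {t : ℕ} (ht : t ≤ I.T) :
    Measurable[rewardSigma I.T r {τ | τ < t}] fun ω => I.hist (fun t a => r t a ω) t := by
  induction t using Nat.strong_induction_on with
  | _ t ih =>
    refine @measurable_to_countable' _ _ _ _ (rewardSigma I.T r {τ | τ < t}) _ fun d => ?_
    have he : (fun ω => I.hist (fun t a => r t a ω) t) ⁻¹' {d} =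
        ⋃ κ : Fin t → ℕ × Fin N,
          (⋂ i : Fin t, (fun ω => I.hist (fun t a => r t a ω) i) ⁻¹' {κ i}) ∩
          (fun ω => I.decision (ofHist (extendHist κ) (fun τ a => r τ a ω) t) t) ⁻¹' {d} := by
      ext ω
      simp only [Set.mem_preimage, Set.mem_singleton_iff, Set.mem_iUnion, Set.mem_inter_iff,
        Set.mem_iInter]
      have hx : ∀ κ : Fin t → ℕ × Fin N, (∀ i : Fin t, I.hist (fun t a => r t a ω) i = κ i) →
          I.hist (fun t a => r t a ω) t =
            I.decision (ofHist (extendHist κ) (fun τ a => r τ a ω) t) t := by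
        intro κ hκ
        rw [hist, I.run_eq_ofHist hT,
          ofHist_congr _ ((forall_lt_eq_extendHist_iff κ _).2 (funext hκ))]
      constructor
      · intro h
        exact ⟨fun i => I.hist (fun t a => r t a ω) i, fun _ => rfl, by rw [← hx _ fun _ => rfl, h]⟩
      · rintro ⟨κ, hκ, h⟩
        rw [hx κ hκ, h]
    rw [he]
    refine MeasurableSet.iUnion fun κ => MeasurableSet.inter (MeasurableSet.iInter fun i => ?_) ?_
    · have h1 : MeasurableSet[rewardSigma I.T r {τ | τ < (i : ℕ)}]
          ((fun ω => I.hist (fun t a => r t a ω) i) ⁻¹' {κ i}) :=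
        ih i i.2 (i.2.le.trans ht) (measurableSet_singleton _)
      have h2 : {τ : ℕ | τ < (i : ℕ)} ⊆ {τ | τ < t} := fun τ hτ => lt_trans hτ i.2
      exact rewardSigma_mono h2 _ h1
    · have h1 : ∀ τ < t, ∀ a, Measurable[rewardSigma I.T r {τ | τ < t}] (r τ a) :=
        fun τ hτ a => measurable_reward (U := {τ | τ < t}) (hτ.trans_le ht) hτ a
      exact measurable_decision_ofHist (y := r) hT (extendHist κ) h1 (measurableSet_singleton d)

lemma measurable_armAt (hT : 1 ≤ I.T) {t : ℕ} (ht : t ≤ I.T) :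
    Measurable[rewardSigma I.T r {τ | τ < t}] fun ω => I.armAt (fun t a => r t a ω) t :=
  measurable_snd.comp (measurable_hist hT ht)

section Noise

variable [IsProbabilityMeasure P] {H : Type*} [NormedAddCommGroup H] [InnerProductSpace ℝ H]
  {φ : X → H}

/-- The confidence bound at a single round, stage and arm. -/
lemma measure_noiseExceeds_le (hk : ∀ x y, I.k x y = inner ℝ (φ x) (φ y)) (hlam : 0 < I.lam)
    (hT : 1 ≤ I.T) (hmeas : ∀ t < I.T, ∀ a, Measurable (r t a))
    (hbdd : ∀ t < I.T, ∀ a, ∀ᵐ ω ∂P, r t a ω ∈ Set.Icc (0 : ℝ) 1)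
    (hind : iIndepFun (fun (t : Fin I.T) ω a => r t a ω) P) {α : ℝ} (hα : 0 ≤ α) {t : ℕ}
    (ht : t < I.T) {q : ℕ} (hq : 1 ≤ q) (a : Fin N) :
    P {ω | I.NoiseExceeds (I.run (fun t a => r t a ω) t) (fun t a => r t a ω)
        (fun t a => ∫ ω', r t a ω' ∂P) α t q a} ≤
      ENNReal.ofReal (2 * Real.exp (-(2 * α ^ 2))) := by
  have hfiber : ∀ κ : Fin t → ℕ × Fin N,
      (fun ω (i : Fin t) => truncate q (I.hist (fun t a => r t a ω) i)) ⁻¹' {κ} =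
        {ω | ∀ τ < t, truncate q (I.hist (fun t a => r t a ω) τ) = extendHist κ τ} := by
    intro κ
    ext ω
    simp only [Set.mem_preimage, Set.mem_singleton_iff, Set.mem_ofPred_eq]
    rw [forall_lt_eq_extendHist_iff κ fun τ => truncate q (I.hist (fun t a => r t a ω) τ)]
  have hA : ∀ κ : Fin t → ℕ × Fin N,
      MeasurableSet[rewardSigma I.T r
        {τ | 1 ≤ (extendHist κ τ).1 ∧ (extendHist κ τ).1 < q}]
        ((fun ω (i : Fin t) => truncate q (I.hist (fun t a => r t a ω) i)) ⁻¹' {κ}) := by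
    intro κ
    rw [hfiber]
    exact measurableSet_truncate_hist hT _ q ht.le
  refine measure_le_of_fibers
    (K := fun ω (i : Fin t) => truncate q (I.hist (fun t a => r t a ω) i))
    (fun κ => rewardSigma_le hmeas _ _ (hA κ)) fun κ => ?_
  -- The rewards stored in this frozen state are irrelevant: the noise event takes its rewards from
  -- the table.
  set σ := ofHist (extendHist κ) 0 t with hσ
  set C := {ω | I.NoiseExceeds σ (fun t a => r t a ω) (fun t a => ∫ ω', r t a ω' ∂P) α t q a}
    with hC
  have hσt : ∀ τ ∈ σ.Psi q, τ < I.T := fun τ hτ =>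
    (Finset.mem_range.1 (ofHist_Psi_subset _ _ _ _ hτ)).trans ht
  have hCm : MeasurableSet[rewardSigma I.T r {τ | (extendHist κ τ).1 = q}] C := by
    refine measurableSet_lt_abs_weightedSum _ _ _ fun i => measurable_reward (hσt i i.2) ?_ _
    exact ((Finset.mem_filter.1 i.2).2).1
  -- On the fibre of κ the random index set and arms of stage q are the frozen ones.
  have hsub : {ω | I.NoiseExceeds (I.run (fun t a => r t a ω) t) (fun t a => r t a ω)
        (fun t a => ∫ ω', r t a ω' ∂P) α t q a} ∩
      (fun ω (i : Fin t) => truncate q (I.hist (fun t a => r t a ω) i)) ⁻¹' {κ} ⊆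
      (fun ω (i : Fin t) => truncate q (I.hist (fun t a => r t a ω) i)) ⁻¹' {κ} ∩ C := by
    rintro ω ⟨h1, h2⟩
    refine ⟨h2, ?_⟩
    rw [hfiber] at h2
    have hag := agreeUpTo_ofHist (fun t a => r t a ω) h2
    rw [← I.run_eq_ofHist hT] at hag
    have hPsi : (I.run (fun t a => r t a ω) t).Psi q = σ.Psi q := hag.Psi_eq q hq le_rfl
    have harm : ∀ τ ∈ (I.run (fun t a => r t a ω) t).Psi q,
        (I.run (fun t a => r t a ω) t).arm τ = σ.arm τ := hag.arm_eq q hq le_rfl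
    rw [Set.mem_ofPred_eq] at h1
    rw [hC, Set.mem_ofPred_eq]
    exact noiseExceeds_congr hPsi harm h1
  have hdisj : Disjoint {τ | 1 ≤ (extendHist κ τ).1 ∧ (extendHist κ τ).1 < q}
      {τ | (extendHist κ τ).1 = q} := by
    rw [Set.disjoint_left]
    rintro τ ⟨_, h⟩ h'
    exact h.ne h'
  refine (measure_mono hsub).trans ?_
  -- The fibre and the frozen noise event use rewards from disjoint sets of rounds, so the
  -- probability of the intersection factors.
  rw [(Indep_iff _ _ _).1 (indep_rewardSigma hmeas hind hdisj) _ _ (hA κ) hCm, mul_comm]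
  gcongr
  exact measure_noise_le hmeas hbdd hind hσt σ.arm _ hα (stdWidth_nonneg _ _ _ _ _)
    (sum_ridgeWeights_sq_le hk hlam _ _ _)

/-- The regret and the regret in terms of expected rewards are close. -/
lemma measure_regret_deviation_le (hT : 1 ≤ I.T) (hmeas : ∀ t < I.T, ∀ a, Measurable (r t a))
    (hbdd : ∀ t < I.T, ∀ a, ∀ᵐ ω ∂P, r t a ω ∈ Set.Icc (0 : ℝ) 1)
    (hind : iIndepFun (fun (t : Fin I.T) ω a => r t a ω) P) (best : ℕ → Fin N) {ε : ℝ}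
    (hε : 0 ≤ ε) :
    P {ω | ε ≤ I.regret (fun t a => r t a ω) (fun t a => r t a ω) best -
        I.regret (fun t a => r t a ω) (fun t a => ∫ ω', r t a ω' ∂P) best} ≤
      ENNReal.ofReal (Real.exp (-ε ^ 2 / (2 * I.T))) := by
  let D : ℕ → Fin N → Ω → ℝ := fun t a ω => (r t (best t) ω - r t a ω) -
    ∫ ω', (r t (best t) ω' - r t a ω') ∂P
  -- A difference of two rewards lies in [−1, 1], which gives variance proxy 1.
  have hD : ∀ t < I.T, ∀ a, HasSubgaussianMGF (D t a) 1 P := by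
    intro t ht a
    have h := hasSubgaussianMGF_of_mem_Icc (μ := P) (a := -1) (b := 1)
      (X := fun ω => r t (best t) ω - r t a ω)
      ((hmeas t ht _).sub (hmeas t ht a)).aemeasurable (by
        filter_upwards [hbdd t ht (best t), hbdd t ht a] with ω h1 h2
        constructor <;> linarith [h1.1, h1.2, h2.1, h2.2])
    convert h
    ext
    norm_num
  have hfresh : ∀ t, rewardSigma I.T r {t} ≤ rewardSigma I.T r {τ | τ < t + 1} := fun t =>
    rewardSigma_mono (Set.singleton_subset_iff.2 (Nat.lt_succ_self t))
  have hmono : ∀ t, rewardSigma I.T r {τ | τ < t} ≤ rewardSigma I.T r {τ | τ < t + 1} := fun t =>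
    rewardSigma_mono fun τ hτ => lt_trans hτ (Nat.lt_succ_self t)
  have hpf : ∀ t < I.T, Indep (rewardSigma I.T r {τ | τ < t}) (rewardSigma I.T r {t}) P :=
    fun t _ => indep_rewardSigma hmeas hind (Set.disjoint_singleton_right.2 (lt_irrefl t))
  have hDm : ∀ t < I.T, ∀ a, Measurable[rewardSigma I.T r {t}] (D t a) := fun t ht a =>
    ((measurable_reward (U := {t}) ht rfl _).sub
      (measurable_reward (U := {t}) ht rfl _)).sub_const _
  have hsub := hasSubgaussianMGF_sum_selected (P := P)
    (past := fun t => rewardSigma I.T r {τ | τ < t}) (fresh := fun t => rewardSigma I.T r {t})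
    (fun t => rewardSigma_le hmeas _) hmono hfresh hpf
    (A := fun t ω => I.armAt (fun t a => r t a ω) t) (fun t ht => measurable_armAt hT ht.le) hDm hD
  have hint : ∀ t < I.T, ∀ a, Integrable (r t a) P := fun t ht a =>
    Integrable.of_mem_Icc 0 1 (hmeas t ht a).aemeasurable (hbdd t ht a)
  have he : ∀ ω, I.regret (fun t a => r t a ω) (fun t a => r t a ω) best -
        I.regret (fun t a => r t a ω) (fun t a => ∫ ω', r t a ω' ∂P) best =
      ∑ t ∈ Finset.range I.T, D t (I.armAt (fun t a => r t a ω) t) ω := by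
    intro ω
    simp only [regret, ← Finset.sum_sub_distrib]
    refine Finset.sum_congr rfl fun t ht => ?_
    have ht' := Finset.mem_range.1 ht
    simp only [D]
    rw [integral_sub (hint t ht' _) (hint t ht' _)]
  simp only [he]
  rw [← ofReal_measureReal]
  refine ENNReal.ofReal_le_ofReal ?_
  simpa using hsub.measure_ge_le hε

end Noise

end Input

/-! ### Numerical estimates. -/

section Numerics

variable {N T : ℕ} {δ : ℝ}

lemma two_thirds_le_log (hT : 2 ≤ T) : 2 / 3 ≤ Real.log T := by
  have h1 : Real.log 2 ≤ Real.log T := Real.log_le_log two_pos (by exact_mod_cast hT)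
  linarith [Real.log_two_gt_d9]

lemma one_le_confidence_arg (hN : 1 ≤ N) (hT : 1 ≤ T) (hδ : 0 < δ) (hδ1 : δ ≤ 1) :
    1 ≤ 2 * T * N * (Real.log T + 1) / δ := by
  have hT' : (1 : ℝ) ≤ T := by exact_mod_cast hT
  have hN' : (1 : ℝ) ≤ N := by exact_mod_cast hN
  have hl := Real.log_nonneg hT'
  rw [le_div_iff₀ hδ, one_mul]
  have h1 : (1 : ℝ) ≤ T * N := one_le_mul_of_one_le_of_one_le hT' hN'
  nlinarith [mul_nonneg (zero_le_one.trans h1) hl]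

lemma two_mul_confidence_sq (hN : 1 ≤ N) (hT : 1 ≤ T) (hδ : 0 < δ) (hδ1 : δ ≤ 1) :
    2 * confidence T N δ ^ 2 = Real.log (2 * T * N * (Real.log T + 1) / δ) := by
  rw [confidence, Real.sq_sqrt]
  · ring
  · exact div_nonneg (Real.log_nonneg (one_le_confidence_arg hN hT hδ hδ1)) two_pos.le

lemma exp_neg_two_mul_confidence_sq (hN : 1 ≤ N) (hT : 1 ≤ T) (hδ : 0 < δ) (hδ1 : δ ≤ 1) :
    Real.exp (-(2 * confidence T N δ ^ 2)) = δ / (2 * T * N * (Real.log T + 1)) := by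
  rw [two_mul_confidence_sq hN hT hδ hδ1, Real.exp_neg, Real.exp_log, inv_div]
  exact zero_lt_one.trans_le (one_le_confidence_arg hN hT hδ hδ1)

lemma confidence_nonneg (T N : ℕ) (δ : ℝ) : 0 ≤ confidence T N δ := Real.sqrt_nonneg _

/-- The total failure probability. -/
lemma failure_probability_le (hN : 1 ≤ N) (hT : 2 ≤ T) (hδ : 0 < δ) (hδ1 : δ ≤ 1) {Q : ℝ}
    (hQ : Q ≤ 3 / 4 * Real.log T + 1) :
    T * N * Q * (2 * Real.exp (-(2 * confidence T N δ ^ 2))) +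
      Real.exp (-(3 * confidence T N δ * √T) ^ 2 / (2 * T)) ≤ δ := by
  have hT0 : (2 : ℝ) ≤ T := by exact_mod_cast hT
  have hN0 : (1 : ℝ) ≤ N := by exact_mod_cast hN
  have hl := two_thirds_le_log hT
  set l := Real.log T with hldef
  have he := exp_neg_two_mul_confidence_sq hN (by omega : 1 ≤ T) hδ hδ1
  rw [← hldef] at he
  set X : ℝ := 2 * T * N * (l + 1) with hX
  have hX4 : 4 * (l + 1) ≤ X := by
    have : (2 : ℝ) ≤ T * N := by nlinarith
    nlinarith
  have h1 : T * N * Q * (2 * (δ / X)) = Q / (l + 1) * δ := by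
    rw [hX]
    field_simp
  -- The exponent is −(9/2)α², and exp(−4α²) = (δ/X)².
  have h2 : Real.exp (-(3 * confidence T N δ * √T) ^ 2 / (2 * T)) ≤ (δ / X) ^ 2 := by
    rw [← he, ← Real.exp_nat_mul, Real.exp_le_exp, mul_pow, Real.sq_sqrt (by linarith)]
    have : -((3 * confidence T N δ) ^ 2 * T) / (2 * T) = -(9 / 2 * confidence T N δ ^ 2) := by
      field_simp
      ring
    rw [this]
    push_cast
    nlinarith [sq_nonneg (confidence T N δ)]
  have h3 : (δ / X) ^ 2 ≤ 1 / (16 * (l + 1)) * δ := by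
    rw [div_pow, div_mul_eq_mul_div, one_mul]
    refine div_le_div₀ hδ.le (by nlinarith) (by positivity) ?_
    nlinarith
  -- The factor 3/4 in the number of stages leaves (1/4) log T ≥ 1/16 spare, which pays for the
  -- deviation event.
  have h4 : Q / (l + 1) + 1 / (16 * (l + 1)) ≤ 1 := by
    have : Q / (l + 1) + 1 / (16 * (l + 1)) = (Q + 1 / 16) / (l + 1) := by
      field_simp
    rw [this, div_le_one (by linarith)]
    linarith
  rw [he, h1]
  calc _ ≤ Q / (l + 1) * δ + 1 / (16 * (l + 1)) * δ := by linarith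
    _ = (Q / (l + 1) + 1 / (16 * (l + 1))) * δ := by ring
    _ ≤ 1 * δ := by gcongr
    _ = δ := one_mul _

/-- Since log 2 ≥ 2/3, the exponent contributes at least (3/4)(2/3) log T = (1/2) log T. -/
lemma sqrt_le_two_pow_ceil (hT : 1 ≤ T) : √(T : ℝ) ≤ 2 ^ ⌈3 / 4 * Real.log T⌉₊ := by
  have hT0 : (0 : ℝ) < T := by exact_mod_cast hT
  have hl : 0 ≤ Real.log T := Real.log_nonneg (by exact_mod_cast hT)
  rw [← Real.log_le_log_iff (Real.sqrt_pos.2 hT0) (by positivity), Real.log_sqrt hT0.le,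
    Real.log_pow]
  have h1 := Nat.le_ceil (3 / 4 * Real.log T)
  have h2 := Real.log_two_gt_d9
  have h3 : (3 / 4 * Real.log T) * (2 / 3) ≤ (⌈3 / 4 * Real.log T⌉₊ : ℝ) * Real.log 2 :=
    mul_le_mul h1 (by linarith) (by norm_num) (by positivity)
  linarith

/-- Both log T and log(log T + 1) are at most log T, and the term free of T is absorbed by 1 ≤ (3/2)
log T. -/
lemma confidence_le (hN : 1 ≤ N) (hT : 2 ≤ T) (hδ : 0 < δ) (hδ1 : δ ≤ 1) :
    confidence T N δ ≤ √((3 / 2 * Real.log (2 * N / δ) + 2) / 2) * √(Real.log T) := by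
  have hT0 : (2 : ℝ) ≤ T := by exact_mod_cast hT
  have hN0 : (1 : ℝ) ≤ N := by exact_mod_cast hN
  have hl := two_thirds_le_log hT
  have hA : 0 ≤ Real.log (2 * N / δ) := by
    refine Real.log_nonneg ?_
    rw [le_div_iff₀ hδ]
    linarith
  rw [← Real.sqrt_mul (by positivity), confidence]
  refine Real.sqrt_le_sqrt ?_
  have h1 : Real.log (2 * T * N * (Real.log T + 1) / δ) =
      Real.log (2 * N / δ) + Real.log T + Real.log (Real.log T + 1) := by
    rw [← Real.log_mul (by positivity) (by positivity), ← Real.log_mul (by positivity)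
      (by positivity)]
    congr 1
    ring
  have h2 : Real.log (Real.log T + 1) ≤ Real.log T := by
    have := Real.log_le_sub_one_of_pos (show 0 < Real.log T + 1 by linarith)
    linarith
  rw [h1]
  nlinarith

/-- The bound on the regret, in the form `C log T √(T L)`. -/
lemma bound_le_mul_log {α d m L l : ℝ} {a₀ : ℝ} (hl : 2 / 3 ≤ l) (hα0 : 0 ≤ α)
    (hα : α ≤ a₀ * √l) (hd : 0 ≤ d) (hm : 1 ≤ m) (hL : 0 ≤ L)
    (hcond : 1 ≤ 2 * m * ⌈l⌉₊ * L) :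
    2 * √(T : ℝ) + 10 * (α + d) * √(2 * m * L) * √(T * ⌈l⌉₊) ≤
      2 * (3 + 10 * a₀ + 15 * d) * √(2 * m) * l * √(T * L) := by
  have hsl : 1 ≤ 3 / 2 * √l := by
    have : 2 / 3 ≤ √l := by
      refine Real.le_sqrt_of_sq_le ?_
      linarith
    linarith
  have hceil : (⌈l⌉₊ : ℝ) ≤ 2 ^ 2 * l := by
    have := (Nat.ceil_lt_add_one (show 0 ≤ l by linarith)).le
    linarith
  have hsc : √(⌈l⌉₊ : ℝ) ≤ 2 * √l := by
    refine (Real.sqrt_le_sqrt hceil).trans_eq ?_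
    rw [Real.sqrt_mul (by norm_num), Real.sqrt_sq (by norm_num)]
  -- The determinant condition lets the leading term 2√T be multiplied by this root.
  have hroot : 1 ≤ √(2 * m * L) * √(⌈l⌉₊ : ℝ) := by
    rw [← Real.sqrt_mul (by positivity), Real.one_le_sqrt]
    linarith
  have hsplit : √(2 * m * L) = √(2 * m) * √L := Real.sqrt_mul (by linarith) _
  have hll : √l * √l = l := Real.mul_self_sqrt (by linarith)
  rw [Real.sqrt_mul (Nat.cast_nonneg T), Real.sqrt_mul (Nat.cast_nonneg T)]
  calc 2 * √(T : ℝ) + 10 * (α + d) * √(2 * m * L) * (√(T : ℝ) * √(⌈l⌉₊ : ℝ))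
      = √(T : ℝ) * (2 * 1 + 10 * (α + d) * (√(2 * m * L) * √(⌈l⌉₊ : ℝ))) := by ring
    _ ≤ √(T : ℝ) * (2 * (√(2 * m * L) * √(⌈l⌉₊ : ℝ)) +
          10 * (α + d) * (√(2 * m * L) * √(⌈l⌉₊ : ℝ))) := by gcongr
    _ = √(T : ℝ) * √(2 * m * L) * ((2 + 10 * (α + d)) * √(⌈l⌉₊ : ℝ)) := by ring
    _ ≤ √(T : ℝ) * √(2 * m * L) * (((3 + 10 * a₀ + 15 * d) * √l) * (2 * √l)) := by
        have hc : 2 + 10 * (α + d) ≤ (3 + 10 * a₀ + 15 * d) * √l := by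
          have := mul_le_mul_of_nonneg_left hsl hd
          linarith
        have hc0 : 0 ≤ 2 + 10 * (α + d) := by linarith
        exact mul_le_mul_of_nonneg_left
          (mul_le_mul hc hsc (Real.sqrt_nonneg _) (hc0.trans hc)) (by positivity)
    _ = 2 * (3 + 10 * a₀ + 15 * d) * √(2 * m) * (√l * √l) * (√(T : ℝ) * √L) := by
        rw [hsplit]
        ring
    _ = _ := by rw [hll]

end Numerics

/-- Take the complement of a measurable hull, as the bad event is not known to be measurable. -/
lemma exists_measurableSet_avoiding {Ω : Type*} {mΩ : MeasurableSpace Ω} {P : Measure Ω}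
    [IsProbabilityMeasure P] {δ : ℝ} (hδ : 0 ≤ δ) {B : Set Ω} (hB : P B ≤ ENNReal.ofReal δ) :
    ∃ E : Set Ω, MeasurableSet E ∧ ENNReal.ofReal (1 - δ) ≤ P E ∧ ∀ ω ∈ E, ω ∉ B := by
  refine ⟨(toMeasurable P B)ᶜ, (measurableSet_toMeasurable P B).compl, ?_, ?_⟩
  · rw [prob_compl_eq_one_sub (measurableSet_toMeasurable P B), measure_toMeasurable,
      ENNReal.ofReal_sub _ hδ, ENNReal.ofReal_one]
    exact tsub_le_tsub_left hB 1
  · exact fun ω hω hB => hω (subset_toMeasurable P B hB)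

/-! ### The good event and the conclusion. -/

namespace Input

variable {N : ℕ} [NeZero N] {X Ω H : Type*} {mΩ : MeasurableSpace Ω} {P : Measure Ω}
  [IsProbabilityMeasure P] [NormedAddCommGroup H] [InnerProductSpace ℝ H] {φ : X → H}
  {I : Input N X} {r : ℕ → Fin N → Ω → ℝ} {f : H} {δ ck : ℝ} {best : ℕ → Fin N}

/-- If the noise is small, then the confidence bound holds. -/
lemma abs_ridgeEstimate_sub_le (hk : ∀ x y, I.k x y = inner ℝ (φ x) (φ y)) (hlam : 0 < I.lam)
    (hT : 1 ≤ I.T) (hf : ‖f‖ ≤ I.c) {y v : ℕ → Fin N → ℝ}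
    (hv : ∀ t < I.T, ∀ a, v t a = inner ℝ f (φ (I.ctx t a))) {t : ℕ} (ht : t < I.T) {q : ℕ}
    {a : Fin N} (h : ¬ I.NoiseExceeds (I.run y t) y v I.alpha t q a) :
    |ridgeEstimate I.k I.lam ((I.run y t).Psi q) (I.played (I.run y t)) (I.run y t).rew
      (I.ctx t a) - v t a| ≤ I.w (I.run y t) t q a := by
  have hlt : ∀ i ∈ (I.run y t).Psi q, i < t := fun i hi => by
    rw [I.run_eq_ofHist hT] at hi
    exact Finset.mem_range.1 (ofHist_Psi_subset _ _ _ _ hi)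
  have hbias := abs_ridgeWeights_bias_le hk hlam ((I.run y t).Psi q) (I.played (I.run y t))
    (I.ctx t a) f hf
  rw [NoiseExceeds, not_lt] at h
  rw [ridgeEstimate_eq_sum hk hlam, hv t ht, w, add_mul]
  -- Each observed reward is its mean plus noise; the means reproduce `f` up to the bias.
  have hsplit : ∑ i : (I.run y t).Psi q, ridgeWeights I.k I.lam ((I.run y t).Psi q)
        (I.played (I.run y t)) (I.ctx t a) i * (I.run y t).rew i =
      ∑ i : (I.run y t).Psi q, ridgeWeights I.k I.lam ((I.run y t).Psi q)
        (I.played (I.run y t)) (I.ctx t a) i *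
          (y i ((I.run y t).arm i) - v i ((I.run y t).arm i)) +
      ∑ i : (I.run y t).Psi q, ridgeWeights I.k I.lam ((I.run y t).Psi q)
        (I.played (I.run y t)) (I.ctx t a) i * inner ℝ f (φ (I.played (I.run y t) i)) := by
    rw [← Finset.sum_add_distrib]
    refine Finset.sum_congr rfl fun i _ => ?_
    have hi := hlt i i.2
    rw [I.run_rew hT y hi, hv i (hi.trans ht), played, I.run_arm hT y hi]
    ring
  rw [hsplit, add_sub_assoc]
  exact (abs_add_le _ _).trans (add_le_add h hbias)

/-- The event on which the regret bounds hold. -/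
lemma exists_good_event (hk : ∀ x y, I.k x y = inner ℝ (φ x) (φ y)) (hlam : 0 < I.lam)
    (hT : 2 ≤ I.T) (hpick : ∀ t q S, S.Nonempty → I.pick t q S ∈ S) (hck : ∀ x, I.k x x ≤ ck)
    (hα : I.alpha = confidence I.T N δ) (hδ : 0 < δ) (hδ1 : δ ≤ 1) (hf : ‖f‖ ≤ I.c)
    (hmeas : ∀ t < I.T, ∀ a, Measurable (r t a))
    (hbdd : ∀ t < I.T, ∀ a, ∀ᵐ ω ∂P, r t a ω ∈ Set.Icc (0 : ℝ) 1)
    (hind : iIndepFun (fun (t : Fin I.T) ω a => r t a ω) P)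
    (hmean : ∀ t < I.T, ∀ a, ∫ ω, r t a ω ∂P = inner ℝ f (φ (I.ctx t a)))
    (hbest : ∀ t < I.T, ∀ a, ∫ ω, r t a ω ∂P ≤ ∫ ω, r t (best t) ω ∂P)
    (hv : ∀ t < I.T, ∀ a, ∫ ω, r t a ω ∂P ∈ Set.Icc (0 : ℝ) 1) :
    ∃ E : Set Ω, MeasurableSet E ∧ ENNReal.ofReal (1 - δ) ≤ P E ∧ ∀ ω ∈ E,
      (∀ x, I.regret (fun t a => r t a ω) (fun t a => ∫ ω', r t a ω' ∂P) best ≤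
        2 * √(I.T : ℝ) + 7 * (I.alpha + I.c * √I.lam) *
          √(2 * max 1 (ck / I.lam) * Real.log (I.g (fun t a => r t a ω) x)) *
          √(I.T * ⌈Real.log I.T⌉₊)) ∧
      I.regret (fun t a => r t a ω) (fun t a => r t a ω) best ≤
        I.regret (fun t a => r t a ω) (fun t a => ∫ ω', r t a ω' ∂P) best +
          3 * I.alpha * √(I.T : ℝ) := by
  have hT1 : 1 ≤ I.T := by omega
  have hN : 1 ≤ N := Nat.one_le_iff_ne_zero.2 (NeZero.ne N)
  have hα0 : 0 ≤ I.alpha := hα ▸ confidence_nonneg _ _ _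
  have hW : 0 ≤ I.alpha + I.c * √I.lam :=
    add_nonneg hα0 (mul_nonneg ((norm_nonneg f).trans hf) (Real.sqrt_nonneg _))
  have hl := two_thirds_le_log hT
  -- This many stages suffice for 2^Q ≥ √T, and it is at most ⌈log T⌉. Stopping the union bound here
  -- leaves room within δ for the event `B₂`.
  set Q := ⌈3 / 4 * Real.log I.T⌉₊ with hQ
  have hQ1 : 1 ≤ Q := Nat.one_le_ceil_iff.2 (by linarith)
  have hQle : (Q : ℝ) ≤ 3 / 4 * Real.log I.T + 1 := (Nat.ceil_lt_add_one (by linarith)).le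
  have hQceil : Q ≤ ⌈Real.log I.T⌉₊ := Nat.ceil_mono (by linarith)
  let B₁ : ℕ × Fin N × ℕ → Set Ω := fun p =>
    {ω | I.NoiseExceeds (I.run (fun t a => r t a ω) p.1) (fun t a => r t a ω)
      (fun t a => ∫ ω', r t a ω' ∂P) I.alpha p.1 p.2.2 p.2.1}
  let idx : Finset (ℕ × Fin N × ℕ) := Finset.range I.T ×ˢ Finset.univ ×ˢ Finset.Icc 1 Q
  let B₂ : Set Ω := {ω | 3 * I.alpha * √(I.T : ℝ) ≤
    I.regret (fun t a => r t a ω) (fun t a => r t a ω) best -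
      I.regret (fun t a => r t a ω) (fun t a => ∫ ω', r t a ω' ∂P) best}
  have hB₁ : P (⋃ p ∈ idx, B₁ p) ≤
      ENNReal.ofReal (I.T * N * Q * (2 * Real.exp (-(2 * I.alpha ^ 2)))) := by
    calc P (⋃ p ∈ idx, B₁ p) ≤ ∑ p ∈ idx, P (B₁ p) := measure_biUnion_finset_le _ _
      _ ≤ ∑ p ∈ idx, ENNReal.ofReal (2 * Real.exp (-(2 * I.alpha ^ 2))) := by
          refine Finset.sum_le_sum fun p hp => ?_
          simp only [idx, Finset.mem_product, Finset.mem_range, Finset.mem_univ, Finset.mem_Icc,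
            true_and] at hp
          exact measure_noiseExceeds_le hk hlam hT1 hmeas hbdd hind hα0 hp.1 hp.2.1 _
      _ = _ := by
          have hcard : idx.card = I.T * (N * Q) := by
            simp [idx, Finset.card_product]
          rw [Finset.sum_const, hcard, nsmul_eq_mul,
            show (I.T * N * Q : ℝ) = ((I.T * (N * Q) : ℕ) : ℝ) by push_cast; ring,
            ENNReal.ofReal_mul (Nat.cast_nonneg _), ENNReal.ofReal_natCast]
  have hB₂ := measure_regret_deviation_le hT1 hmeas hbdd hind best
    (show 0 ≤ 3 * I.alpha * √(I.T : ℝ) by positivity)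
  have hB : P ((⋃ p ∈ idx, B₁ p) ∪ B₂) ≤ ENNReal.ofReal δ := by
    refine (measure_union_le _ _).trans ((add_le_add hB₁ hB₂).trans ?_)
    rw [← ENNReal.ofReal_add (by positivity) (by positivity)]
    refine ENNReal.ofReal_le_ofReal ?_
    rw [hα]
    exact failure_probability_le hN hT hδ hδ1 hQle
  obtain ⟨E, hE, hPE, hav⟩ := exists_measurableSet_avoiding hδ.le hB
  refine ⟨E, hE, hPE, fun ω hω => ⟨fun x => ?_, ?_⟩⟩
  · have hgood : ∀ t < I.T, ∀ a q, 1 ≤ q → q ≤ Q →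
        |ridgeEstimate I.k I.lam ((I.run (fun t a => r t a ω) t).Psi q)
          (I.played (I.run (fun t a => r t a ω) t)) (I.run (fun t a => r t a ω) t).rew
          (I.ctx t a) - ∫ ω', r t a ω' ∂P| ≤ I.w (I.run (fun t a => r t a ω) t) t q a := by
      intro t ht a q hq1 hq
      refine abs_ridgeEstimate_sub_le (v := fun t a => ∫ ω', r t a ω' ∂P) hk hlam hT1 hf hmean ht
        fun hne => hav ω hω (Or.inl ?_)
      refine Set.mem_biUnion (x := (t, a, q)) ?_ hne
      simp [idx, ht, hq1, hq]
    refine (regret_le_of_good hk hlam hT1 hpick hck hW hQ1 (sqrt_le_two_pow_ceil hT1) _ _ hgood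
      hbest hv x).trans ?_
    gcongr
  · have h2 : ω ∉ B₂ := fun h => hav ω hω (Or.inr h)
    rw [Set.mem_ofPred_eq, not_le] at h2
    linarith

end Input

end KMTL

end

theorem theorem1 (N : ℕ) [NeZero N] (lam c ck δ : ℝ) (hlam : 0 < lam)
    (hδ : 0 < δ) :
    -- the constant of the `O`-bound depends on nothing but `N`, `λ`, `c`, `c_k` and `δ`
    ∃ C : ℝ, ∀ (Z : Type*) (X : Type*) (kZ : Z → Z → ℝ) (kX : X → X → ℝ),
      KMTL.IsSPDKernel kZ → KMTL.IsSPDKernel kX →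
      (∀ p : Z × X, KMTL.productKernel kZ kX p p ≤ ck) →
      -- `H` is the RKHS of the product kernel, `f` the target function
      ∀ (H : Type*) [NormedAddCommGroup H] [InnerProductSpace ℝ H] [CompleteSpace H]
        [RKHS ℝ H (Z × X) ℝ],
      (∀ p q : Z × X, RKHS.kernel H p q 1 = KMTL.productKernel kZ kX p q) →
      ∀ f : H, ‖f‖ ≤ c →
      -- the arm descriptors, the contexts, the horizon and the rule that breaks ties
      ∀ (z : Fin N → Z) (x : ℕ → Fin N → X) (T : ℕ), 1 ≤ T →
      ∀ pick : ℕ → ℕ → Finset (Fin N) → Fin N, (∀ t q S, S.Nonempty → pick t q S ∈ S) →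
      -- the rewards
      ∀ (Ω : Type*) [MeasurableSpace Ω] (P : Measure Ω) [IsProbabilityMeasure P]
        (r : ℕ → Fin N → Ω → ℝ),
      (∀ t < T, ∀ a, Measurable (r t a)) →
      (∀ t < T, ∀ a, ∀ᵐ ω ∂P, r t a ω ∈ Set.Icc (0 : ℝ) 1) →
      iIndepFun (fun (t : Fin T) ω a => r t a ω) P →
      (∀ t < T, ∀ a, ∫ ω, r t a ω ∂P = f (z a, x t a)) →
      -- the best arms
      ∀ best : ℕ → Fin N, (∀ t < T, ∀ a, f (z a, x t a) ≤ f (z (best t), x t (best t))) →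
      let alg : KMTL.Input N (Z × X) :=
        { k := KMTL.productKernel kZ kX
          lam := lam
          c := c
          alpha := KMTL.confidence T N δ
          T := T
          ctx := fun t a => (z a, x t a)
          pick := pick }
      let m : ℝ := max 1 (ck / lam)
      ∃ E : Set Ω, MeasurableSet E ∧ ENNReal.ofReal (1 - δ) ≤ P E ∧
        ∀ ω ∈ E, ∀ xlast : Z × X,
          let rew : ℕ → Fin N → ℝ := fun t a => r t a ω
          let L : ℝ := Real.log (alg.g rew xlast)
          let bound : ℝ := 2 * √T +
            10 * (√(Real.log (2 * T * N * (Real.log T + 1) / δ) / 2) + c * √lam) *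
              √(2 * m * L) * √(T * ⌈Real.log T⌉₊)
          -- the regret in terms of expected rewards
          alg.regret rew (fun t a => ∫ ω', r t a ω' ∂P) best ≤ bound ∧
          -- the regret in terms of the rewards themselves
          ((2 ≤ T → 1 ≤ 2 * m * ⌈Real.log T⌉₊ * L) →
            alg.regret rew rew best ≤ bound ∧
            (2 ≤ T → alg.regret rew rew best ≤ C * Real.log T * √(T * L))) := by
  have hN : 1 ≤ N := Nat.one_le_iff_ne_zero.2 (NeZero.ne N)
  refine ⟨2 * (3 + 10 * √((3 / 2 * Real.log (2 * N / δ) + 2) / 2) + 15 * (c * √lam)) *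
    √(2 * max 1 (ck / lam)), ?_⟩
  intro Z X kZ kX _ _ hck H _ _ _ _ hker f hf z x T hT pick hpick Ω _ P _ r hmeas hbdd hind hmean
    best hbest alg m
  have hc : 0 ≤ c := (norm_nonneg f).trans hf
  -- For δ > 1 the empty event suffices; the estimates for α need δ ≤ 1.
  rcases lt_or_ge 1 δ with hδ1 | hδ1
  · refine ⟨∅, MeasurableSet.empty, ?_, fun ω hω => absurd hω (Set.notMem_empty ω)⟩
    rw [ENNReal.ofReal_of_nonpos (by linarith)]
    exact zero_le
  have hv : ∀ t < T, ∀ a, ∫ ω, r t a ω ∂P ∈ Set.Icc (0 : ℝ) 1 := fun t ht a =>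
    (convex_Icc (0 : ℝ) 1).integral_mem isClosed_Icc (hbdd t ht a)
      (Integrable.of_mem_Icc 0 1 (hmeas t ht a).aemeasurable (hbdd t ht a))
  -- The feature map is p ↦ `RKHS.kerFun H p 1`, and evaluation of `f` is the inner product with it.
  have hk : ∀ p q, alg.k p q = inner ℝ (RKHS.kerFun H p (1 : ℝ)) (RKHS.kerFun H q (1 : ℝ)) := by
    intro p q
    have h := RKHS.kernel_inner H p q (1 : ℝ) (1 : ℝ)
    rw [hker p q, real_inner_comm (RKHS.kerFun H p (1 : ℝ))] at h
    rw [← h]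
    simp [alg]
  have hfin : ∀ p, inner ℝ f (RKHS.kerFun H p (1 : ℝ)) = f p := by
    intro p
    simp
  -- For T = 1 the logarithm vanishes and the bound is 2, while the regret of one round is at most
  -- 1.
  rcases eq_or_lt_of_le hT with hT1 | hT2
  · subst hT1
    have hnull : P {ω | ¬ ∀ a, r 0 a ω ∈ Set.Icc (0 : ℝ) 1} ≤ ENNReal.ofReal δ := by
      have h : ∀ᵐ ω ∂P, ∀ a, r 0 a ω ∈ Set.Icc (0 : ℝ) 1 :=
        ae_all_iff.2 fun a => hbdd 0 one_pos a
      rw [ae_iff.1 h]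
      exact zero_le
    obtain ⟨E, hE, hPE, hav⟩ := KMTL.exists_measurableSet_avoiding hδ.le hnull
    refine ⟨E, hE, hPE, fun ω hω xlast => ?_⟩
    have hω' : ∀ a, r 0 a ω ∈ Set.Icc (0 : ℝ) 1 := not_not.1 (hav ω hω)
    intro rew L bound
    have hbound : bound = 2 := by simp [bound]
    have hreg : ∀ v : ℕ → Fin N → ℝ, (∀ a, v 0 a ∈ Set.Icc (0 : ℝ) 1) →
        alg.regret rew v best ≤ bound := by
      intro v hv
      have h1 := (hv (best 0)).2
      have h2 := (hv (alg.armAt rew 0)).1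
      rw [hbound]
      simp only [KMTL.Input.regret, alg, Finset.sum_range_one] at h2 ⊢
      linarith
    exact ⟨hreg _ (hv 0 one_pos), fun _ => ⟨hreg _ hω', fun h => absurd h (by norm_num)⟩⟩
  · obtain ⟨E, hE, hPE, hgood⟩ := KMTL.Input.exists_good_event (I := alg) (P := P) (r := r)
      (f := f) (δ := δ) (ck := ck) (best := best) hk hlam hT2 hpick hck rfl hδ hδ1 hf hmeas hbdd
      hind (fun t ht a => (hmean t ht a).trans (hfin _).symm)
      (fun t ht a => by rw [hmean t ht, hmean t ht]; exact hbest t ht a) hv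
    refine ⟨E, hE, hPE, fun ω hω xlast => ?_⟩
    intro rew L bound
    obtain ⟨h1, h2⟩ := hgood ω hω
    have h1 : alg.regret rew (fun t a => ∫ ω', r t a ω' ∂P) best ≤ 2 * √T +
        7 * (KMTL.confidence T N δ + c * √lam) * √(2 * m * L) * √(T * ⌈Real.log T⌉₊) := h1 xlast
    have h2 : alg.regret rew rew best ≤ alg.regret rew (fun t a => ∫ ω', r t a ω' ∂P) best +
        3 * KMTL.confidence T N δ * √T := h2
    have hbound : bound = 2 * √T + 10 * (KMTL.confidence T N δ + c * √lam) * √(2 * m * L) *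
        √(T * ⌈Real.log T⌉₊) := rfl
    have hα := KMTL.confidence_nonneg T N δ
    have hd : 0 ≤ c * √lam := by positivity
    have hL : 0 ≤ L := Real.log_nonneg (KMTL.Input.one_le_g hk hlam rew xlast)
    have hm : 1 ≤ m := le_max_left _ _
    have hR : 0 ≤ (KMTL.confidence T N δ + c * √lam) * (√(2 * m * L) * √(T * ⌈Real.log T⌉₊)) := by
      positivity
    refine ⟨?_, fun hcond => ?_⟩
    · rw [hbound]
      linarith
    have hcond := hcond hT2
    -- This is where the determinant condition enters: it turns the deviation 3α√T into 3 copies of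
    -- the main term.
    have hroot : √T ≤ √(2 * m * L) * √(T * ⌈Real.log T⌉₊) := by
      rw [← Real.sqrt_mul (by positivity)]
      refine Real.sqrt_le_sqrt ?_
      have := mul_le_mul_of_nonneg_left hcond (Nat.cast_nonneg (α := ℝ) T)
      linarith
    have hreg : alg.regret rew rew best ≤ bound := by
      have h3 : KMTL.confidence T N δ * √T ≤ (KMTL.confidence T N δ + c * √lam) *
          (√(2 * m * L) * √(T * ⌈Real.log T⌉₊)) :=
        mul_le_mul (by linarith) hroot (Real.sqrt_nonneg _) (by positivity)
      rw [hbound]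
      linarith
    refine ⟨hreg, fun _ => hreg.trans ?_⟩
    rw [hbound]
    exact KMTL.bound_le_mul_log (KMTL.two_thirds_le_log hT2) hα
      (KMTL.confidence_le hN hT2 hδ hδ1) hd hm hL hcond
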